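/- Let $\mathcal X$ be a unital $C^*$-algebra and $E$ its state space, i.e. the weak$^*$-compact convex set of all $\rho\in\mathcal X^*$ with $\rho(A^*A)\ge 0$ for all $A\in\mathcal X$ and $\rho(\mathbf 1)=1$. Let $\mathfrak C=C(E;\mathbb C)$ with the supremum norm, put $\hat A(\rho)=\rho(A)$ for $A\in\mathcal X$, and let $\mathfrak C_{\mathcal X}\subseteq\mathfrak C$ be the complex algebra of polynomials generated by $\{\hat A:A\in\mathcal X\}$. A function $f\in\mathfrak C$ is continuously differentiable if for every $\rho\in E$ there is a continuous affine function $\mathrm df(\rho):E\to\mathbb C$ with $$[\mathrm df(\rho)](\upsilon)=\lim_{\lambda\to0^+}\lambda^{-1}\bigl(f((1-\lambda)\rho+\lambda\upsilon)-f(\rho)\bigr),\qquad \upsilon\in E,$$ and $\rho\mapsto\mathrm df(\rho)$ is continuous in the supremum norm. Then $\mathrm df(\rho)$ is the function $\upsilon\mapsto\upsilon(\mathrm Df(\rho))$ for a unique $\mathrm Df(\rho)\in\mathcal X$, and for continuously differentiable $f,g$ one sets $\{f,g\}(\rho)=\rho\bigl(i[\mathrm Df(\rho),\mathrm Dg(\rho)]\bigr)$.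 Let $\mathfrak Z$ be the set of families $(h(t))_{t\in\mathbb R}$ of functions on $E$ of the form $h(t;\rho)=g(t;\rho(B_1),\dots,\rho(B_n))$ with $n\in\mathbb N$, $B_1,\dots,B_n\in\mathcal X$ self-adjoint, and $g$ a bounded continuous map from $\mathbb R$ to the Banach space $C_b^3(\mathbb R^n;\mathbb R)$ of $C^3$ functions bounded together with their derivatives up to order $3$. Take $h\in\mathfrak Z$ constant in time. For every weak$^*$-continuous curve $\xi:\mathbb R\to E$ there is a unique family $(T^\xi_{t,s})_{s,t\in\mathbb R}$ of bounded operators on $\mathcal X$ with $$\partial_tT^\xi_{t,s}=T^\xi_{t,s}\circ i[\mathrm Dh(\xi(t)),\,\cdot\,]\ \text{ (in operator norm)},\qquad T^\xi_{s,s}=\mathbf 1,$$ and there is a unique family $(s,t)\mapsto\varpi(s,t)$ of self-homeomorphisms of $E$, continuous on $\mathbb R^2$ for the topology of uniform convergence, such that $$\varpi(s,t)(\rho)=\rho\circ T^{\varpi(s,\cdot)(\rho)}_{t,s},\qquad s,t\in\mathbb R,\ \rho\in E.$$ Set $V_{t,0}^h(f)=f\circ\varpi(0,t)$ for $f\in\mathfrak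 C$. Then $(V_{t,0}^h)_{t\in\mathbb R}$ is a $C_0$-group of $*$-automorphisms of $\mathfrak C$; let $\daleth^h$ be its generator. The function $h$ is continuously differentiable, and for every $t\in\mathbb R$ and $f\in\mathfrak C_{\mathcal X}$ the functions $f$ and $V_{t,0}^h(f)$ are continuously differentiable and belong to the domain of $\daleth^h$, $\{h,f\}\in\mathfrak C$, and $$\partial_tV_{t,0}^h(f)=V_{t,0}^h\circ\daleth^h(f)=V_{t,0}^h(\{h,f\})=\{h,V_{t,0}^h(f)\}=\daleth^h\circ V_{t,0}^h(f),$$ where the derivative is taken in the norm of $\mathfrak C$. -/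

import Mathlib

open Topology Filter Set
open scoped ComplexOrder unitInterval

noncomputable section

/-- The state space `E` of a unital C⋆-algebra `X`: the positive normalized functionals in the
dual of `X`, with the weak-⋆ topology. -/
def stateSet (X : Type*) [CStarAlgebra X] : Set (WeakDual ℂ X) :=
  {ρ | (∀ A : X, 0 ≤ ρ (star A * A)) ∧ ρ 1 = 1}

/-- The state space as a topological space. -/
abbrev StateSpace (X : Type*) [CStarAlgebra X] : Type _ := ↥(stateSet X)

theorem norm_state_apply_le {X : Type*} [CStarAlgebra X] {ρ : WeakDual ℂ X} (hρ : ρ ∈ stateSet X)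
    (A : X) : ‖ρ A‖ ≤ ‖A‖ := by
  let _ := CStarAlgebra.spectralOrder X
  have _ := CStarAlgebra.spectralOrderedRing X
  let φ : X →ₚ[ℂ] ℂ := PositiveLinearMap.mk₀ (ρ : X →ₗ[ℂ] ℂ) (by
    intro a ha
    obtain ⟨b, rfl⟩ := CStarAlgebra.nonneg_iff_eq_star_mul_self.mp ha
    exact hρ.1 b)
  have hφ : ∀ a, φ a = ρ a := fun a => rfl
  have h1 := norm_inner_le_norm (𝕜 := ℂ) (φ.toPreGNS 1) (φ.toPreGNS A)
  have h2 := φ.preGNS_norm_sq (φ.toPreGNS 1)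
  have h3 := φ.preGNS_norm_sq (φ.toPreGNS A)
  rw [φ.preGNS_inner_def] at h1
  simp only [PositiveLinearMap.ofPreGNS_toPreGNS, star_one, one_mul, mul_one, hφ, hρ.2] at h1 h2 h3
  have h4 := φ.norm_apply_le_of_nonneg (star A * A) (star_mul_self_nonneg A)
  simp only [hφ, hρ.2, norm_one, one_mul, CStarRing.norm_star_mul_self] at h4
  rw [← h3] at h4
  have h5 : ‖φ.toPreGNS 1‖ = 1 := by
    have h6 : ‖φ.toPreGNS 1‖ ^ 2 = 1 := by exact_mod_cast h2
    nlinarith [norm_nonneg (φ.toPreGNS 1)]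
  rw [h5, one_mul] at h1
  refine h1.trans ?_
  simp only [norm_pow, Complex.norm_real, norm_norm] at h4
  nlinarith [norm_nonneg (φ.toPreGNS A), norm_nonneg A]

instance instCompactSpaceStateSpace (X : Type*) [CStarAlgebra X] : CompactSpace (StateSpace X) := by
  rw [← isCompact_iff_compactSpace]
  refine (WeakDual.isCompact_closedBall (𝕜 := ℂ) (E := X) 0 1).of_isClosed_subset ?_ ?_
  · have h : stateSet X =
        (⋂ A : X, {ρ : WeakDual ℂ X | 0 ≤ ρ (star A * A)}) ∩ {ρ : WeakDual ℂ X | ρ 1 = 1} := by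
      ext ρ; simp [stateSet]
    rw [h]
    exact (isClosed_iInter fun A => isClosed_le continuous_const
      (WeakDual.eval_continuous _)).inter (isClosed_eq (WeakDual.eval_continuous _)
        continuous_const)
  · intro ρ hρ
    simp only [mem_preimage, mem_closedBall_zero_iff]
    exact ContinuousLinearMap.opNorm_le_bound _ zero_le_one fun A => by
      rw [one_mul]; exact norm_state_apply_le hρ A

namespace StateSpace

/-- The convex combination `(1 - l) ρ + l υ` of two states. -/
def mix {X : Type*} [CStarAlgebra X] (ρ υ : StateSpace X) (l : I) : StateSpace X :=
  ⟨(1 - (l : ℂ)) • ρ.1 + (l : ℂ) • υ.1, by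
    have hl : (0 : ℂ) ≤ (l : ℂ) := by exact_mod_cast l.2.1
    have hl' : (0 : ℂ) ≤ 1 - (l : ℂ) := by
      have := sub_nonneg.2 l.2.2
      exact_mod_cast this
    constructor
    · intro A
      exact add_nonneg (mul_nonneg hl' (ρ.2.1 A)) (mul_nonneg hl (υ.2.1 A))
    · change (1 - (l : ℂ)) * ρ.1 1 + (l : ℂ) * υ.1 1 = 1
      rw [ρ.2.2, υ.2.2]; ring⟩

end StateSpace

/-- The Gelfand transform `Â : ρ ↦ ρ(A)` of an element of `X`. -/
def gelfandHat {X : Type*} [CStarAlgebra X] (A : X) : C(StateSpace X, ℂ) :=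
  ⟨fun ρ => ρ.1 A, (WeakDual.eval_continuous A).comp continuous_subtype_val⟩

/-- The polynomial functions on `E`: the complex algebra generated by the Gelfand transforms. -/
def polynomialsOnStates (X : Type*) [CStarAlgebra X] : Subalgebra ℂ C(StateSpace X, ℂ) :=
  Algebra.adjoin ℂ (range gelfandHat)

/-- `d` is the convex weak-⋆ continuous Gateaux derivative of `f` at `ρ`: a continuous affine
function on `E` with `d(υ) = lim_{l → 0⁺} l⁻¹ (f((1 - l) ρ + l υ) - f(ρ))` for every state `υ`. -/
def HasConvexGateauxDeriv {X : Type*} [CStarAlgebra X] (f : C(StateSpace X, ℂ)) (ρ : StateSpace X)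
    (d : C(StateSpace X, ℂ)) : Prop :=
  (∀ (τ υ : StateSpace X) (l : I),
    d (τ.mix υ l) = (1 - (l : ℂ)) * d τ + (l : ℂ) * d υ) ∧
  ∀ υ : StateSpace X,
    Tendsto (fun l : I => (l : ℂ)⁻¹ * (f (ρ.mix υ l) - f ρ)) (𝓝[>] 0) (𝓝 (d υ))

/-- `f` is continuously differentiable on `E`: its convex Gateaux derivative exists at every state
and depends continuously on the state, for the supremum norm of affine functions on `E`. -/
def IsContDiffOnStates {X : Type*} [CStarAlgebra X] (f : C(StateSpace X, ℂ)) : Prop :=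
  ∃ d : C(StateSpace X, C(StateSpace X, ℂ)), ∀ ρ, HasConvexGateauxDeriv f ρ (d ρ)

open Classical in
/-- `D f(ρ)`: the element of `X` whose Gelfand transform is the convex Gateaux derivative of `f`
at `ρ`. It is unique since states separate the elements of `X`, and it exists whenever `f` is
differentiable at `ρ`, since every continuous affine function on `E` is a Gelfand transform. -/
def stateGradient {X : Type*} [CStarAlgebra X] (f : C(StateSpace X, ℂ)) (ρ : StateSpace X) : X :=
  if H : ∃ A : X, HasConvexGateauxDeriv f ρ (gelfandHat A) then H.choose else 0

/-- The Poisson bracket `{f, g}(ρ) = ρ(i [D f(ρ), D g(ρ)])`. -/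
def poissonBracket {X : Type*} [CStarAlgebra X] (f g : C(StateSpace X, ℂ)) (ρ : StateSpace X) : ℂ :=
  ρ.1 (Complex.I • (stateGradient f ρ * stateGradient g ρ - stateGradient g ρ * stateGradient f ρ))

/-- The class of time-dependent cylindrical Hamiltonians
`h(t; ρ) = g(t; ρ(B₁), …, ρ(Bₙ))` with `B₁, …, Bₙ` self-adjoint and `g` a bounded continuous
map from `ℝ` to the Banach space of real-valued `C³` functions on `ℝⁿ` that are bounded with all
their derivatives of order at most three. -/
def cylindricalHamiltonians (X : Type*) [CStarAlgebra X] : Set (ℝ → C(StateSpace X, ℂ)) :=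
  {h | ∃ (n : ℕ) (B : Fin n → X) (g : ℝ → (Fin n → ℝ) → ℝ),
    (∀ j, IsSelfAdjoint (B j)) ∧
    (∀ t, ContDiff ℝ 3 (g t)) ∧
    (∃ M : ℝ, ∀ t x, ∀ m ≤ 3, ‖iteratedFDeriv ℝ m (g t) x‖ ≤ M) ∧
    (∀ t₀, ∀ m ≤ 3, TendstoUniformly (fun t x => iteratedFDeriv ℝ m (g t) x)
      (fun x => iteratedFDeriv ℝ m (g t₀) x) (𝓝 t₀)) ∧
    ∀ t ρ, h t ρ = ((g t (fun j => (ρ.1 (B j)).re) : ℝ) : ℂ)}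

/-- The bounded derivation `A ↦ i [D h(ρ), A]` of `X`. -/
def quantumGenerator {X : Type*} [CStarAlgebra X] (h : C(StateSpace X, ℂ)) (ρ : StateSpace X) :
    X →L[ℂ] X :=
  Complex.I • (ContinuousLinearMap.mul ℂ X (stateGradient h ρ) -
    (ContinuousLinearMap.mul ℂ X).flip (stateGradient h ρ))

/-- `T` is the two-parameter family of operators on `X` that solves, in the operator norm,
`∂ₜ T(t, s) = T(t, s) ∘ i [D h(t; ξ(t)), ·]` and `T(s, s) = 1`. -/
def IsQuantumEvolution {X : Type*} [CStarAlgebra X] (h : ℝ → C(StateSpace X, ℂ))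
    (ξ : C(ℝ, StateSpace X)) (T : ℝ → ℝ → (X →L[ℂ] X)) : Prop :=
  (∀ s t, HasDerivAt (fun τ => T τ s) ((T t s).comp (quantumGenerator (h t) (ξ t))) t) ∧
  ∀ s, T s s = ContinuousLinearMap.id ℂ X

/-- `ϖ`, a continuous family `(s, t) ↦ ϖ(s, t)` of self-homeomorphisms of `E` (for the topology of
uniform convergence), solves the self-consistency equation `ϖ(s, t)(ρ) = ρ ∘ T(t, s)`, in which
`T` is the quantum evolution along the curve `t ↦ ϖ(s, t)(ρ)`. -/
def IsSelfConsistentFlow {X : Type*} [CStarAlgebra X] (h : ℝ → C(StateSpace X, ℂ))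
    (ϖ : C(ℝ × ℝ, C(StateSpace X, StateSpace X))) : Prop :=
  (∀ p, IsHomeomorph (ϖ p)) ∧
  ∀ (s : ℝ) (ρ : StateSpace X), ∃ (ξ : C(ℝ, StateSpace X)) (T : ℝ → ℝ → (X →L[ℂ] X)),
    (∀ t, ξ t = ϖ (s, t) ρ) ∧ IsQuantumEvolution h ξ T ∧
    ∀ (t : ℝ) (A : X), (ϖ (s, t) ρ).1 A = ρ.1 (T t s A)

/-- The classical evolution `V(t, s) f = f ∘ ϖ(s, t)` on the C⋆-algebra `C(E; ℂ)`. -/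
def classicalEvolution {X : Type*} [CStarAlgebra X]
    (ϖ : C(ℝ × ℝ, C(StateSpace X, StateSpace X))) (t s : ℝ) :
    C(StateSpace X, ℂ) →⋆ₐ[ℂ] C(StateSpace X, ℂ) :=
  ContinuousMap.compStarAlgHom' ℂ ℂ (ϖ (s, t))

/-- `V` is a strongly continuous one-parameter group of ⋆-automorphisms. -/
def IsC0Group {𝔄 : Type*} [CStarAlgebra 𝔄] (V : ℝ → (𝔄 →⋆ₐ[ℂ] 𝔄)) : Prop :=
  (∀ t, Function.Bijective (V t)) ∧ V 0 = StarAlgHom.id ℂ 𝔄 ∧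
  (∀ s t, V (s + t) = (V s).comp (V t)) ∧ ∀ f, Continuous fun t => V t f

/-- The generator of `V`: the operator `f ↦ lim_{t → 0} t⁻¹ (V(t) f - f)`, whose domain is the set
of all `f` for which the limit exists in norm. -/
def groupGenerator {𝔄 : Type*} [CStarAlgebra 𝔄] (V : ℝ → (𝔄 →⋆ₐ[ℂ] 𝔄)) : 𝔄 →ₗ.[ℂ] 𝔄 where
  domain :=
    { carrier := {f | ∃ g, Tendsto (fun t : ℝ => t⁻¹ • (V t f - f)) (𝓝[≠] 0) (𝓝 g)}
      add_mem' := by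
        rintro a b ⟨g, hg⟩ ⟨k, hk⟩
        refine ⟨g + k, (hg.add hk).congr fun t => ?_⟩
        rw [map_add, ← smul_add]; congr 1; abel
      zero_mem' := ⟨0, by simp⟩
      smul_mem' := by
        rintro c a ⟨g, hg⟩
        refine ⟨c • g, (hg.const_smul c).congr fun t => ?_⟩
        rw [map_smul, ← smul_sub, smul_comm] }
  toFun :=
    { toFun := fun f => f.2.choose
      map_add' := fun a b => by
        refine tendsto_nhds_unique (a + b).2.choose_spec
          ((a.2.choose_spec.add b.2.choose_spec).congr fun t => ?_)
        simp only [Submodule.coe_add]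
        rw [map_add, ← smul_add]; congr 1; abel
      map_smul' := fun c a => by
        refine tendsto_nhds_unique (c • a).2.choose_spec
          ((a.2.choose_spec.const_smul c).congr fun t => ?_)
        simp only [Submodule.coe_smul]
        rw [map_smul, ← smul_sub, smul_comm] }

end

noncomputable section

/-! ### Linear growth ordinary differential equations -/

section ODE

variable {Y : Type*} [NormedAddCommGroup Y] [NormedSpace ℝ Y]

/-! The self-consistency equation is an autonomous ODE in disguise. Differentiating `ρ ∘ T` along
its own curve gives `φ' = D.field φ` in the dual of `X`, with `D.field φ = ∑ⱼ ∂ⱼg(φ(B)) φ ∘ i[Bⱼ,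
·]`. This field is locally Lipschitz with linear growth, so its integral curves are global, and
uniqueness for the ODE gives uniqueness of `ϖ`. With the coefficients frozen along a solution, the
equation becomes linear and is solved by conjugations `A ↦ u A u⋆` (`exists_inner_evolution`); hence
solutions starting at states remain states (`IsTrajectory.mem_stateSet`).

To control all initial states at once, the ODE is solved in the Banach space of operators from `X`
to `C(E; ℂ)`, starting at the Gelfand transform (`exists_flow`). The solution `Phi` sends `A` to its
transform composed with the flow, so weak-⋆ continuity in `ρ` and norm differentiability in `t` come
for free. The Leibniz rule extends norm differentiability to polynomials, and the group law carries
it to all times.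

The bracket needs gradients of `f` composed with the flow. The linearized equation is solved in dual
form, with values in `C(E; X)` (`exists_linearizedFlow`), and a quadratic Grönwall estimate
(`exists_norm_flow_mix_sub_le`) shows that its solution provides these gradients. A chain rule along
the flow (`hasDerivAt_apply_flow`) gives the pointwise time derivative as a Poisson bracket. In
`exists_hasDerivAt_pullback` this pointwise value identifies the norm derivative already known to
exist. -/

theorem norm_le_gronwallBound_of_hasDerivAt {u u' : ℝ → Y} {δ K ε a b : ℝ}
    (hu : ∀ t ∈ uIcc a b, HasDerivAt u (u' t) t) (ha : ‖u a‖ ≤ δ)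
    (bound : ∀ t ∈ uIcc a b, ‖u' t‖ ≤ K * ‖u t‖ + ε) :
    ‖u b‖ ≤ gronwallBound δ K ε |b - a| := by
  rcases le_total a b with hab | hab
  · rw [uIcc_of_le hab] at hu bound
    rw [abs_of_nonneg (sub_nonneg.2 hab)]
    exact norm_le_gronwallBound_of_norm_deriv_right_le
      (fun t ht => (hu t ht).continuousAt.continuousWithinAt)
      (fun t ht => (hu t (Ico_subset_Icc_self ht)).hasDerivWithinAt) ha
      (fun t ht => bound t (Ico_subset_Icc_self ht)) b (right_mem_Icc.2 hab)
  -- Backwards in time, the forward estimate is applied to `t ↦ u (-t)`.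
  · rw [uIcc_of_ge hab] at hu bound
    rw [abs_of_nonpos (sub_nonpos.2 hab)]
    have hmem : ∀ t ∈ Icc (-a) (-b), -t ∈ Icc b a := fun t ht =>
      ⟨le_neg.1 ht.2, neg_le.1 ht.1⟩
    have hd : ∀ t ∈ Icc (-a) (-b), HasDerivAt (fun t => u (-t)) (-u' (-t)) t := fun t ht => by
      have := (hu (-t) (hmem t ht)).scomp t (hasDerivAt_neg t)
      simpa using! this
    have := norm_le_gronwallBound_of_norm_deriv_right_le (f := fun t => u (-t))
      (f' := fun t => -u' (-t)) (δ := δ) (K := K) (ε := ε)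
      (fun t ht => (hd t ht).continuousAt.continuousWithinAt)
      (fun t ht => (hd t (Ico_subset_Icc_self ht)).hasDerivWithinAt) (by simpa using ha)
      (fun t ht => by simpa using bound (-t) (hmem t (Ico_subset_Icc_self ht)))
      (-b) (right_mem_Icc.2 (neg_le_neg hab))
    simpa [sub_eq_add_neg, add_comm] using this

theorem eq_of_hasDerivAt_of_norm_sub_le {u v u' v' : ℝ → Y} {K a b : ℝ}
    (hu : ∀ t ∈ uIcc a b, HasDerivAt u (u' t) t) (hv : ∀ t ∈ uIcc a b, HasDerivAt v (v' t) t)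
    (ha : u a = v a) (bound : ∀ t ∈ uIcc a b, ‖u' t - v' t‖ ≤ K * ‖u t - v t‖) :
    u b = v b := by
  have := norm_le_gronwallBound_of_hasDerivAt (u := fun t => u t - v t) (δ := 0) (ε := 0)
    (fun t ht => (hu t ht).sub (hv t ht)) (by simp [ha]) (by simpa using bound)
  rw [gronwallBound_ε0_δ0] at this
  exact sub_eq_zero.1 (norm_le_zero_iff.1 this)

theorem continuous_of_forall_hasDerivAt {u u' : ℝ → Y} (h : ∀ t, HasDerivAt u (u' t) t) :
    Continuous u :=
  continuous_iff_continuousAt.2 fun t => (h t).continuousAt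

/-- The cutoff is 1-Lipschitz, equals 1 on the ball of radius `R` and vanishes outside that of
radius `R + 1`. In the splitting `(χ x - χ y) • F x + χ y • (F x - F y)` the point `x` is taken in
the larger ball, which symmetry allows. -/
theorem lipschitzWith_cutoff_smul {F : Y → Y} {K R : ℝ} (hK : 0 ≤ K) (hR : 0 ≤ R) {L : NNReal}
    (hF : ∀ x, ‖F x‖ ≤ K * ‖x‖) (hL : LipschitzOnWith L F (Metric.closedBall 0 (R + 1))) :
    LipschitzWith (Real.toNNReal (K * (R + 1) + L))
      (fun x => max 0 (min 1 (R + 1 - ‖x‖)) • F x) := by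
  set χ : Y → ℝ := fun x => max 0 (min 1 (R + 1 - ‖x‖)) with hχ
  have hχ0 : ∀ x, 0 ≤ χ x := fun x => le_max_left _ _
  have hχ1 : ∀ x, χ x ≤ 1 := fun x => max_le zero_le_one (min_le_left _ _)
  have hχl : ∀ x y, |χ x - χ y| ≤ ‖x - y‖ := fun x y => by
    refine (abs_max_sub_max_le_max _ _ _ _).trans (max_le (by simp) ?_)
    refine (abs_min_sub_min_le_max _ _ _ _).trans (max_le (by simp) ?_)
    rw [sub_sub_sub_cancel_left, ← norm_sub_rev]
    exact abs_norm_sub_norm_le y x |>.trans_eq (by rw [norm_sub_rev])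
  have hout : ∀ x, R + 1 < ‖x‖ → χ x = 0 := fun x hx =>
    max_eq_left ((min_le_right _ _).trans (by linarith))
  have hC : 0 ≤ K * (R + 1) + L := by positivity
  have key : ∀ x y, ‖x‖ ≤ R + 1 → ‖χ x • F x - χ y • F y‖ ≤ (K * (R + 1) + L) * ‖x - y‖ := by
    intro x y hx
    have hFx : ‖F x‖ ≤ K * (R + 1) := (hF x).trans (by gcongr)
    have h1 : ‖(χ x - χ y) • F x‖ ≤ K * (R + 1) * ‖x - y‖ := by
      rw [norm_smul, Real.norm_eq_abs, mul_comm]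
      exact mul_le_mul hFx (hχl x y) (abs_nonneg _) (by positivity)
    have h2 : ‖χ y • (F x - F y)‖ ≤ L * ‖x - y‖ := by
      by_cases hy : ‖y‖ ≤ R + 1
      · rw [norm_smul, Real.norm_eq_abs, abs_of_nonneg (hχ0 y)]
        have := hL.norm_sub_le (by simpa using hx) (by simpa using hy)
        calc χ y * ‖F x - F y‖ ≤ 1 * (L * ‖x - y‖) := by
              gcongr
              exact hχ1 y
          _ = _ := one_mul _
      · rw [hout y (not_le.1 hy), zero_smul, norm_zero]; positivity
    calc ‖χ x • F x - χ y • F y‖ = ‖(χ x - χ y) • F x + χ y • (F x - F y)‖ := by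
          congr 1; rw [sub_smul, smul_sub]; abel
      _ ≤ _ := (norm_add_le _ _).trans (by linarith)
  refine LipschitzWith.of_dist_le_mul fun x y => ?_
  rw [dist_eq_norm, dist_eq_norm, Real.coe_toNNReal _ hC]
  by_cases hx : ‖x‖ ≤ R + 1
  · exact key x y hx
  by_cases hy : ‖y‖ ≤ R + 1
  · rw [norm_sub_rev, norm_sub_rev x y]; exact key y x hy
  · change ‖χ x • F x - χ y • F y‖ ≤ _
    rw [hout x (not_le.1 hx), hout y (not_le.1 hy)]
    simp only [zero_smul, sub_zero, norm_zero]; positivity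

variable [CompleteSpace Y]

/-- The field is cut off beyond the a priori Grönwall radius `R`. The cut-off field has the same
linear growth bound, so its solution never leaves the ball where the cutoff is 1 and solves the
original equation. -/
theorem exists_hasDerivAt_Icc_of_linear_growth {F : ℝ → Y → Y} {K T : ℝ} (hT : 0 ≤ T)
    (hK : 0 ≤ K) (hcont : ∀ x, Continuous fun t => F t x)
    (hlip : ∀ R, ∃ L : NNReal, ∀ t ∈ Icc (-(T + 1)) (T + 1),
      LipschitzOnWith L (F t) (Metric.closedBall 0 R))
    (hF : ∀ t ∈ Icc (-(T + 1)) (T + 1), ∀ x, ‖F t x‖ ≤ K * ‖x‖) (x₀ : Y) :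
    ∃ u : ℝ → Y, u 0 = x₀ ∧ ∀ t ∈ Icc (-T) T,
      HasDerivAt u (F t (u t)) t ∧ ‖u t‖ ≤ Real.exp (K * T) * ‖x₀‖ := by
  set R : ℝ := Real.exp (K * T) * ‖x₀‖ with hR
  have hR0 : 0 ≤ R := by positivity
  obtain ⟨L, hL⟩ := hlip (R + 1)
  set χ : Y → ℝ := fun x => max 0 (min 1 (R + 1 - ‖x‖)) with hχ
  have hχ0 : ∀ x, 0 ≤ χ x := fun x => le_max_left _ _
  have hχ1 : ∀ x, χ x ≤ 1 := fun x => max_le zero_le_one (min_le_left _ _)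
  have hnorm : ∀ t ∈ Icc (-(T + 1)) (T + 1), ∀ x, ‖χ x • F t x‖ ≤ K * ‖x‖ := fun t ht x => by
    rw [norm_smul, Real.norm_eq_abs, abs_of_nonneg (hχ0 x)]
    exact (mul_le_of_le_one_left (norm_nonneg _) (hχ1 x)).trans (hF t ht x)
  have hbdd : ∀ t ∈ Icc (-(T + 1)) (T + 1), ∀ x, ‖χ x • F t x‖ ≤ K * (R + 1) := fun t ht x => by
    by_cases hx : ‖x‖ ≤ R + 1
    · exact (hnorm t ht x).trans (by gcongr)
    · have : χ x = 0 := max_eq_left ((min_le_right _ _).trans (by linarith))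
      rw [this, zero_smul, norm_zero]; positivity
  have h0 : (0 : ℝ) ∈ Icc (-(T + 1)) (T + 1) := ⟨by linarith, by linarith⟩
  have hKR : 0 ≤ K * (R + 1) := by positivity
  -- The cut-off field is bounded by `K * (R + 1)` everywhere, so the ball may be chosen as large as
  -- the whole time interval requires.
  have hPL : IsPicardLindelof (fun t x => χ x • F t x) (⟨0, h0⟩ : Icc (-(T + 1)) (T + 1)) x₀
      (Real.toNNReal (K * (R + 1) * (T + 1))) 0 (Real.toNNReal (K * (R + 1)))
      (Real.toNNReal (K * (R + 1) + L)) :=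
    { lipschitzOnWith := fun t ht =>
        (lipschitzWith_cutoff_smul hK hR0 (hF t ht) (hL t ht)).lipschitzOnWith
      continuousOn := fun x _ => ((hcont x).const_smul (χ x)).continuousOn
      norm_le := fun t ht x _ => by
        rw [Real.coe_toNNReal _ hKR]; exact hbdd t ht x
      mul_max_le := by
        rw [Real.coe_toNNReal _ hKR, Real.coe_toNNReal _ (by positivity)]
        simp }
  obtain ⟨u, hu0, hu⟩ := hPL.exists_eq_forall_mem_Icc_hasDerivWithinAt₀
  have hsub : ∀ t ∈ Icc (-T) T, t ∈ Icc (-(T + 1)) (T + 1) := fun t ht =>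
    ⟨by linarith [ht.1], by linarith [ht.2]⟩
  -- The extra unit of time makes `-T` and `T` interior points, so the derivatives there are
  -- two-sided.
  have hd : ∀ t ∈ Icc (-T) T, HasDerivAt u (χ (u t) • F t (u t)) t := fun t ht =>
    (hu t (hsub t ht)).hasDerivAt (Icc_mem_nhds (by linarith [ht.1]) (by linarith [ht.2]))
  have hb : ∀ t ∈ Icc (-T) T, ‖u t‖ ≤ R := fun t ht => by
    have hI : uIcc 0 t ⊆ Icc (-T) T := ordConnected_Icc.uIcc_subset
      (show (0 : ℝ) ∈ Icc (-T) T from ⟨by linarith, hT⟩) ht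
    have := norm_le_gronwallBound_of_hasDerivAt (u := u) (a := 0) (b := t) (δ := ‖x₀‖) (ε := 0)
      (K := K) (fun s hs => hd s (hI hs)) (by rw [← hu0])
      (fun s hs => by simpa using hnorm s (hsub s (hI hs)) (u s))
    rw [gronwallBound_ε0, sub_zero, mul_comm] at this
    refine this.trans ?_
    rw [hR]
    gcongr
    exact abs_le.2 ht
  refine ⟨u, hu0, fun t ht => ⟨?_, hb t ht⟩⟩
  have : χ (u t) = 1 := by
    rw [hχ]; dsimp only
    rw [min_eq_left (by linarith [hb t ht]), max_eq_right zero_le_one]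
  simpa [this] using hd t ht

theorem exists_forall_hasDerivAt_of_linear_growth {F : ℝ → Y → Y}
    (hcont : ∀ x, Continuous fun t => F t x)
    (hlip : ∀ T R : ℝ, ∃ L : NNReal, ∀ t ∈ Icc (-T) T,
      LipschitzOnWith L (F t) (Metric.closedBall 0 R))
    (hF : ∀ T : ℝ, ∃ K, 0 ≤ K ∧ ∀ t ∈ Icc (-T) T, ∀ x, ‖F t x‖ ≤ K * ‖x‖) (x₀ : Y) :
    ∃ u : ℝ → Y, u 0 = x₀ ∧ ∀ t, HasDerivAt u (F t (u t)) t := by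
  have hex : ∀ N : ℕ, ∃ u : ℝ → Y, u 0 = x₀ ∧ ∃ R, ∀ t ∈ Icc (-(N : ℝ)) N,
      HasDerivAt u (F t (u t)) t ∧ ‖u t‖ ≤ R := fun N => by
    obtain ⟨K, hK, hKF⟩ := hF (N + 1)
    obtain ⟨u, h0, hu⟩ := exists_hasDerivAt_Icc_of_linear_growth (Nat.cast_nonneg N) hK hcont
      (hlip (N + 1)) hKF x₀
    exact ⟨u, h0, _, hu⟩
  choose u hu0 R hu using hex
  have hagree : ∀ N M : ℕ, ∀ t : ℝ, |t| ≤ N → |t| ≤ M → u N t = u M t := by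
    intro N M t hN hM
    obtain ⟨L, hL⟩ := hlip |t| (max (R N) (R M))
    have hI : ∀ s ∈ uIcc 0 t, |s| ≤ |t| := fun s hs => by
      rcases le_total 0 t with ht | ht
      · rw [uIcc_of_le ht] at hs
        rw [abs_of_nonneg hs.1, abs_of_nonneg ht]; exact hs.2
      · rw [uIcc_of_ge ht] at hs
        rw [abs_of_nonpos hs.2, abs_of_nonpos ht]; linarith [hs.1]
    have hIN : ∀ s ∈ uIcc 0 t, s ∈ Icc (-(N : ℝ)) N := fun s hs => abs_le.1 ((hI s hs).trans hN)
    have hIM : ∀ s ∈ uIcc 0 t, s ∈ Icc (-(M : ℝ)) M := fun s hs => abs_le.1 ((hI s hs).trans hM)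
    refine eq_of_hasDerivAt_of_norm_sub_le (a := 0) (K := L) (fun s hs => (hu N s (hIN s hs)).1)
      (fun s hs => (hu M s (hIM s hs)).1) ((hu0 N).trans (hu0 M).symm) fun s hs => ?_
    refine (hL s (abs_le.1 (hI s hs))).norm_sub_le ?_ ?_
    · simpa using Or.inl (hu N s (hIN s hs)).2
    · simpa using Or.inr (hu M s (hIM s hs)).2
  -- The `+ 1` makes `|t|` strictly smaller than the index, so the glued function agrees with a
  -- single `u N` near `t`.
  refine ⟨fun t => u (⌈|t|⌉₊ + 1) t, by simp [hu0], fun t => ?_⟩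
  have hlt : |t| < ((⌈|t|⌉₊ + 1 : ℕ) : ℝ) := by
    push_cast; exact (Nat.le_ceil _).trans_lt (lt_add_one _)
  refine (hu (⌈|t|⌉₊ + 1) t (abs_le.1 hlt.le)).1.congr_of_eventuallyEq ?_
  filter_upwards [(continuous_abs.tendsto t).eventually (gt_mem_nhds hlt)] with s hs
  refine hagree _ _ s ?_ hs.le
  push_cast; exact (Nat.le_ceil _).trans (by linarith)

theorem exists_forall_hasDerivAt_linear {L : ℝ → (Y →L[ℝ] Y)} (hL : Continuous L) (t₀ : ℝ)
    (x₀ : Y) : ∃ u : ℝ → Y, u t₀ = x₀ ∧ ∀ t, HasDerivAt u (L t (u t)) t := by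
  have hK : ∀ T : ℝ, ∃ K : ℝ, 0 ≤ K ∧ ∀ t ∈ Icc (-T) T, ‖L (t + t₀)‖ ≤ K := fun T => by
    obtain ⟨K, hK⟩ := (isCompact_Icc (a := -T) (b := T)).exists_bound_of_continuousOn
      (f := fun t => L (t + t₀)) (by fun_prop)
    exact ⟨max K 0, le_max_right _ _, fun t ht => (hK t ht).trans (le_max_left _ _)⟩
  obtain ⟨u, hu0, hu⟩ := exists_forall_hasDerivAt_of_linear_growth
    (F := fun t x => L (t + t₀) x) (fun x => by fun_prop)
    (fun T R => by
      obtain ⟨K, hK0, hK⟩ := hK T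
      refine ⟨⟨K, hK0⟩, fun t ht => ?_⟩
      exact ((L (t + t₀)).lipschitz.weaken (hK t ht)).lipschitzOnWith)
    (fun T => by
      obtain ⟨K, hK0, hK⟩ := hK T
      exact ⟨K, hK0, fun t ht x => (L (t + t₀)).le_of_opNorm_le (hK t ht) x⟩) x₀
  refine ⟨fun t => u (t - t₀), by simp [hu0], fun t => ?_⟩
  have := (hu (t - t₀)).comp_sub_const t t₀
  simpa using this

end ODE

/-! ### States -/

/-- One of `a`, `-a` lies outside the closed positive cone. Hahn–Banach separates it from the cone
by a positive real functional, which is then normalized and complexified. -/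
theorem exists_state_apply_ne_zero {X : Type*} [CStarAlgebra X] {a : X} (ha : IsSelfAdjoint a)
    (ha0 : a ≠ 0) : ∃ ρ : StateSpace X, ρ.1 a ≠ 0 := by
  let _ := CStarAlgebra.spectralOrder X
  have _ := CStarAlgebra.spectralOrderedRing X
  have hne : ∃ b : X, IsSelfAdjoint b ∧ ¬ 0 ≤ b ∧ (b = a ∨ b = -a) := by
    by_contra! H
    have h1 : 0 ≤ a := by_contra fun h => (H a ha h).1 rfl
    have h2 : 0 ≤ -a := by_contra fun h => (H (-a) ha.neg h).2 rfl
    exact ha0 (le_antisymm (neg_nonneg.1 h2) h1)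
  obtain ⟨b, hb, hb0, hba⟩ := hne
  let C : ProperCone ℝ X :=
    { carrier := {x | 0 ≤ x}
      add_mem' := fun {x y} hx hy => show (0 : X) ≤ x + y from add_nonneg hx hy
      zero_mem' := le_refl (0 : X)
      smul_mem' := fun c x hx => by
        change 0 ≤ (c : ℝ) • x
        exact smul_nonneg c.2 hx
      isClosed' := CStarAlgebra.isClosed_nonneg }
  obtain ⟨f, hf, hfb⟩ := C.hyperplane_separation_point (x₀ := b) hb0
  have hf : ∀ x : X, 0 ≤ x → 0 ≤ f x := fun x hx => hf x hx
  -- From `-‖b‖ ≤ b` follows `0 ≤ f b + ‖b‖ * f 1`, while `f b < 0`.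
  have h1 : 0 < f 1 := by
    have h2 := hf _ (sub_nonneg.2 hb.neg_algebraMap_norm_le_self)
    rw [sub_neg_eq_add, map_add, Algebra.algebraMap_eq_smul_one, map_smul, smul_eq_mul] at h2
    nlinarith [norm_nonneg b]
  -- Precomposing with the projection onto the self-adjoint part makes the complexified functional
  -- real on self-adjoint elements.
  let S : X →L[ℝ] X := (2⁻¹ : ℝ) • (ContinuousLinearMap.id ℝ X + (starL' ℝ : X ≃L[ℝ] X))
  have hS : ∀ x, S x = (2⁻¹ : ℝ) • (x + star x) := fun x => rfl
  have hSsa : ∀ x, IsSelfAdjoint x → S x = x := fun x hx => by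
    rw [hS, hx.star_eq, ← two_smul ℝ x, smul_smul]; norm_num
  have hSI : ∀ x, IsSelfAdjoint x → S (Complex.I • x) = 0 := fun x hx => by
    rw [hS, star_smul, hx.star_eq]; simp
  let φ : X →L[ℂ] ℂ := StrongDual.extendRCLike ((f 1)⁻¹ • (f.comp S))
  have hφ : ∀ x, IsSelfAdjoint x → φ x = (((f 1)⁻¹ * f x : ℝ) : ℂ) := fun x hx => by
    simp [φ, StrongDual.extendRCLike_apply, hSsa x hx, hSI x hx]
  refine ⟨⟨StrongDual.toWeakDual φ, fun A => ?_, ?_⟩, ?_⟩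
  · change 0 ≤ φ (star A * A)
    rw [hφ _ (IsSelfAdjoint.star_mul_self A)]
    have := hf _ (star_mul_self_nonneg A)
    exact_mod_cast mul_nonneg (inv_nonneg.2 h1.le) this
  · change φ 1 = 1
    rw [hφ _ (IsSelfAdjoint.one X), inv_mul_cancel₀ h1.ne']; simp
  · change φ a ≠ 0
    have hb' : φ b ≠ 0 := by
      rw [hφ b hb]
      exact_mod_cast (mul_neg_of_pos_of_neg (inv_pos.2 h1) hfb).ne
    rcases hba with rfl | rfl
    · exact hb'
    · simpa using hb'

namespace StateSpace

variable {X : Type*} [CStarAlgebra X]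

/-- A state as an element of the normed dual. -/
def toDual (ρ : StateSpace X) : X →L[ℂ] ℂ := WeakDual.toStrongDual ρ.1

@[simp] theorem toDual_apply (ρ : StateSpace X) (A : X) : ρ.toDual A = ρ.1 A := rfl

theorem toDual_injective : Function.Injective (toDual : StateSpace X → _) := fun _ _ h =>
  Subtype.ext (WeakDual.toStrongDual.injective h)

theorem norm_toDual_le (ρ : StateSpace X) : ‖ρ.toDual‖ ≤ 1 :=
  ContinuousLinearMap.opNorm_le_bound _ zero_le_one fun A => by
    rw [one_mul]; exact norm_state_apply_le ρ.2 A

theorem apply_one (ρ : StateSpace X) : ρ.1 1 = 1 := ρ.2.2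

/-- Polarization: positivity on the squares of `1 + A` and of `A` leaves `2 ρ(A)` real. -/
theorem apply_im_eq_zero (ρ : StateSpace X) {A : X} (hA : IsSelfAdjoint A) : (ρ.1 A).im = 0 := by
  have h1 : (ρ.1 (star (1 + A) * (1 + A))).im = 0 := (Complex.nonneg_iff.1 (ρ.2.1 _)).2.symm
  have h2 : (ρ.1 (star A * A)).im = 0 := (Complex.nonneg_iff.1 (ρ.2.1 _)).2.symm
  have h3 : star (1 + A) * (1 + A) = 1 + (A + A) + star A * A := by
    rw [star_add, star_one, hA.star_eq]; noncomm_ring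
  rw [h3, map_add, map_add, map_add, ρ.apply_one] at h1
  simp only [Complex.add_im, Complex.one_im, h2] at h1
  linarith

theorem ofReal_re_apply (ρ : StateSpace X) {A : X} (hA : IsSelfAdjoint A) :
    (((ρ.1 A).re : ℝ) : ℂ) = ρ.1 A :=
  Complex.ext (by simp) (by simp [ρ.apply_im_eq_zero hA])

theorem mix_apply (ρ υ : StateSpace X) (l : I) (A : X) :
    (ρ.mix υ l).1 A = (1 - (l : ℂ)) * ρ.1 A + (l : ℂ) * υ.1 A := rfl

theorem mix_zero (ρ υ : StateSpace X) : ρ.mix υ 0 = ρ :=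
  toDual_injective (by ext A; simp [mix_apply])

theorem mix_one (ρ υ : StateSpace X) : ρ.mix υ 1 = υ :=
  toDual_injective (by ext A; simp [mix_apply])

theorem continuous_iff_apply {S : Type*} [TopologicalSpace S] {f : S → StateSpace X} :
    Continuous f ↔ ∀ A : X, Continuous fun s => (f s).1 A := by
  rw [continuous_induced_rng]
  exact ⟨fun h A => (WeakDual.eval_continuous A).comp h, fun h => WeakDual.continuous_of_continuous_eval h⟩

theorem continuous_mix (ρ υ : StateSpace X) : Continuous (ρ.mix υ) := by
  rw [continuous_iff_apply]
  intro A
  simp only [mix_apply]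
  fun_prop

end StateSpace

/-! ### Gelfand transforms and gradients on the state space -/

variable {X : Type*} [CStarAlgebra X]

@[simp] theorem gelfandHat_apply (A : X) (ρ : StateSpace X) : gelfandHat A ρ = ρ.1 A := rfl

/-- The Gelfand transform as a bounded operator. -/
def gelfandHatCLM (X : Type*) [CStarAlgebra X] : X →L[ℂ] C(StateSpace X, ℂ) :=
  LinearMap.mkContinuous
    { toFun := gelfandHat
      map_add' := fun A B => by ext ρ; simp
      map_smul' := fun c A => by ext ρ; simp } 1 fun A => by
    rw [one_mul]
    exact (ContinuousMap.norm_le _ (norm_nonneg _)).2 fun ρ => norm_state_apply_le ρ.2 A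

@[simp] theorem gelfandHatCLM_apply (A : X) : gelfandHatCLM X A = gelfandHat A := rfl

theorem gelfandHat_injective : Function.Injective (gelfandHat : X → _) := by
  suffices H : ∀ A : X, (∀ ρ : StateSpace X, ρ.1 A = 0) → A = 0 by
    intro A B h
    refine sub_eq_zero.1 (H _ fun ρ => ?_)
    have := DFunLike.congr_fun h ρ
    rw [map_sub, sub_eq_zero]; exact this
  have Hsa : ∀ A : X, IsSelfAdjoint A → (∀ ρ : StateSpace X, ρ.1 A = 0) → A = 0 := by
    intro A hA h
    by_contra h0
    obtain ⟨ρ, hρ⟩ := exists_state_apply_ne_zero hA h0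
    exact hρ (h ρ)
  intro A h
  have hdec : A = (realPart A : X) + Complex.I • (imaginaryPart A : X) :=
    (realPart_add_I_smul_imaginaryPart A).symm
  have key : ∀ ρ : StateSpace X, ρ.1 (realPart A : X) = 0 ∧ ρ.1 (imaginaryPart A : X) = 0 := by
    intro ρ
    have h1 := h ρ
    rw [hdec, map_add, map_smul, ← ρ.ofReal_re_apply (realPart A).2,
      ← ρ.ofReal_re_apply (imaginaryPart A).2, smul_eq_mul] at h1
    rw [← ρ.ofReal_re_apply (realPart A).2, ← ρ.ofReal_re_apply (imaginaryPart A).2]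
    have hre := congrArg Complex.re h1
    have him := congrArg Complex.im h1
    simp at hre him
    simp [hre, him]
  rw [hdec, Hsa _ (realPart A).2 fun ρ => (key ρ).1, Hsa _ (imaginaryPart A).2 fun ρ => (key ρ).2]
  simp

instance nhdsGT_zero_unitInterval_neBot : (𝓝[>] (0 : I)).NeBot :=
  nhdsGT_neBot_of_exists_gt ⟨1, zero_lt_one⟩

theorem tendsto_coe_nhdsGT_zero : Tendsto (fun l : I => (l : ℝ)) (𝓝[>] 0) (𝓝[>] 0) := by
  refine tendsto_nhdsWithin_iff.2 ⟨?_, ?_⟩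
  · exact (continuous_subtype_val.tendsto (0 : I)).mono_left nhdsWithin_le_nhds
  · filter_upwards [self_mem_nhdsWithin] with l hl
    exact hl

theorem HasConvexGateauxDeriv.unique {f : C(StateSpace X, ℂ)} {ρ : StateSpace X}
    {d e : C(StateSpace X, ℂ)} (hd : HasConvexGateauxDeriv f ρ d)
    (he : HasConvexGateauxDeriv f ρ e) : d = e := by
  ext υ
  exact tendsto_nhds_unique (hd.2 υ) (he.2 υ)

theorem stateGradient_eq {f : C(StateSpace X, ℂ)} {ρ : StateSpace X} {A : X}
    (h : HasConvexGateauxDeriv f ρ (gelfandHat A)) : stateGradient f ρ = A := by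
  have H : ∃ A : X, HasConvexGateauxDeriv f ρ (gelfandHat A) := ⟨A, h⟩
  rw [stateGradient, dif_pos H]
  exact gelfandHat_injective (H.choose_spec.unique h)

/-- `F` is a norm-continuous field of gradients of `f`. -/
def HasStateGradient (f : C(StateSpace X, ℂ)) (F : C(StateSpace X, X)) : Prop :=
  ∀ ρ υ : StateSpace X,
    Tendsto (fun l : I => (l : ℂ)⁻¹ * (f (ρ.mix υ l) - f ρ)) (𝓝[>] 0) (𝓝 (υ.1 (F ρ)))

namespace HasStateGradient

variable {f g : C(StateSpace X, ℂ)} {F G : C(StateSpace X, X)}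

theorem hasConvexGateauxDeriv (h : HasStateGradient f F) (ρ : StateSpace X) :
    HasConvexGateauxDeriv f ρ (gelfandHat (F ρ)) :=
  ⟨fun _ _ _ => rfl, h ρ⟩

theorem stateGradient_eq (h : HasStateGradient f F) (ρ : StateSpace X) :
    stateGradient f ρ = F ρ :=
  _root_.stateGradient_eq (h.hasConvexGateauxDeriv ρ)

theorem isContDiffOnStates (h : HasStateGradient f F) : IsContDiffOnStates f :=
  ⟨⟨fun ρ => gelfandHatCLM X (F ρ), by fun_prop⟩, h.hasConvexGateauxDeriv⟩

/-- Mixing `ρ` with itself does not move it. This normalization fixes the multiple of the unit in a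
gradient. -/
theorem apply_self (h : HasStateGradient f F) (ρ : StateSpace X) : ρ.1 (F ρ) = 0 := by
  refine tendsto_nhds_unique (h ρ ρ) (tendsto_const_nhds.congr fun l => ?_)
  have : ρ.mix ρ l = ρ := StateSpace.toDual_injective (by
    ext A; simp only [StateSpace.toDual_apply, StateSpace.mix_apply]; ring)
  rw [this, sub_self, mul_zero]

theorem add (hf : HasStateGradient f F) (hg : HasStateGradient g G) :
    HasStateGradient (f + g) (F + G) := fun ρ υ => by
  have := (hf ρ υ).add (hg ρ υ)
  rw [← map_add] at this
  refine this.congr fun l => ?_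
  simp only [ContinuousMap.add_apply]; ring

theorem mul (hf : HasStateGradient f F) (hg : HasStateGradient g G) :
    HasStateGradient (f * g) (g • F + f • G) := fun ρ υ => by
  have hlim : Tendsto (fun l : I => g (ρ.mix υ l)) (𝓝[>] 0) (𝓝 (g ρ)) := by
    have := ((g.continuous.comp (StateSpace.continuous_mix ρ υ)).tendsto 0).mono_left
      (nhdsWithin_le_nhds (s := Ioi (0 : I)))
    simpa [StateSpace.mix_zero] using! this
  have := ((hf ρ υ).mul hlim).add ((hg ρ υ).const_mul (f ρ))
  have hval : υ.1 ((g • F + f • G) ρ) = υ.1 (F ρ) * g ρ + f ρ * υ.1 (G ρ) := by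
    rw [ContinuousMap.add_apply, map_add]
    change υ.1 (g ρ • F ρ) + υ.1 (f ρ • G ρ) = _
    rw [map_smul, map_smul, smul_eq_mul, smul_eq_mul]; ring
  rw [hval]
  refine this.congr fun l => ?_
  simp only [ContinuousMap.mul_apply]; ring

theorem algebraMap (c : ℂ) : HasStateGradient (algebraMap ℂ C(StateSpace X, ℂ) c) 0 :=
  fun ρ υ => by simp

end HasStateGradient

/-! ### The vector field of a cylindrical Hamiltonian -/

/-- The data `(B, g)` of a time-independent cylindrical Hamiltonian `ρ ↦ g(ρ(B₁), …, ρ(Bₙ))`. -/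
structure CylindricalData (X : Type*) [CStarAlgebra X] where
  n : ℕ
  B : Fin n → X
  g : (Fin n → ℝ) → ℝ
  M : ℝ
  isSelfAdjoint : ∀ j, IsSelfAdjoint (B j)
  contDiff : ContDiff ℝ 3 g
  bound : ∀ m ≤ 3, ∀ x, ‖iteratedFDeriv ℝ m g x‖ ≤ M

namespace CylindricalData

variable {X : Type*} [CStarAlgebra X] (D : CylindricalData X)

theorem M_nonneg : 0 ≤ D.M := (norm_nonneg _).trans (D.bound 0 (by norm_num) 0)

/-- The partial derivative `∂ⱼ g`. -/
def c (j : Fin D.n) (x : Fin D.n → ℝ) : ℝ := fderiv ℝ D.g x (Pi.single j 1)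

/-- The second partial derivative `∂ₖ ∂ⱼ g`. -/
def cc (j k : Fin D.n) (x : Fin D.n → ℝ) : ℝ := fderiv ℝ (D.c j) x (Pi.single k 1)

theorem norm_single_one_le (j : Fin D.n) : ‖(Pi.single j 1 : Fin D.n → ℝ)‖ ≤ 1 := by
  rw [Pi.norm_single]; simp

theorem c_eq_comp (j : Fin D.n) :
    D.c j = ContinuousLinearMap.apply ℝ ℝ (Pi.single j 1 : Fin D.n → ℝ) ∘ fderiv ℝ D.g := rfl

theorem contDiff_fderiv : ContDiff ℝ 2 (fderiv ℝ D.g) :=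
  D.contDiff.fderiv_right (by norm_num)

theorem contDiff_c (j : Fin D.n) : ContDiff ℝ 2 (D.c j) := by
  rw [c_eq_comp]
  exact (ContinuousLinearMap.contDiff _).comp D.contDiff_fderiv

theorem norm_iteratedFDeriv_c_le (j : Fin D.n) (x : Fin D.n → ℝ) {m : ℕ} (hm : m ≤ 2) :
    ‖iteratedFDeriv ℝ m (D.c j) x‖ ≤ D.M := by
  rw [c_eq_comp]
  refine (ContinuousLinearMap.norm_iteratedFDeriv_comp_left _ D.contDiff_fderiv.contDiffAt
    (by exact_mod_cast hm)).trans ?_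
  rw [norm_iteratedFDeriv_fderiv]
  have h1 : ‖ContinuousLinearMap.apply ℝ ℝ (Pi.single j 1 : Fin D.n → ℝ)‖ ≤ 1 :=
    ContinuousLinearMap.opNorm_le_bound _ zero_le_one fun L => by
      rw [one_mul]
      exact (L.le_opNorm _).trans (mul_le_of_le_one_right (norm_nonneg _) (D.norm_single_one_le j))
  exact (mul_le_of_le_one_left (norm_nonneg _) h1).trans (D.bound (m + 1) (by omega) x)

theorem abs_c_le (j : Fin D.n) (x : Fin D.n → ℝ) : |D.c j x| ≤ D.M := by
  simpa using D.norm_iteratedFDeriv_c_le j x (m := 0) (by norm_num)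

theorem norm_fderiv_c_le (j : Fin D.n) (x : Fin D.n → ℝ) : ‖fderiv ℝ (D.c j) x‖ ≤ D.M := by
  have := D.norm_iteratedFDeriv_c_le j x (m := 1) (by norm_num)
  rwa [← norm_iteratedFDeriv_fderiv, norm_iteratedFDeriv_zero] at this

theorem norm_fderiv_fderiv_c_le (j : Fin D.n) (x : Fin D.n → ℝ) :
    ‖fderiv ℝ (fderiv ℝ (D.c j)) x‖ ≤ D.M := by
  have := D.norm_iteratedFDeriv_c_le j x (m := 2) le_rfl
  rwa [← norm_iteratedFDeriv_fderiv, ← norm_iteratedFDeriv_fderiv, norm_iteratedFDeriv_zero] at this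

theorem differentiable_c (j : Fin D.n) : Differentiable ℝ (D.c j) :=
  (D.contDiff_c j).differentiable (by norm_num)

theorem differentiable_fderiv_c (j : Fin D.n) : Differentiable ℝ (fderiv ℝ (D.c j)) :=
  ((D.contDiff_c j).fderiv_right (m := 1) (by norm_num)).differentiable (by norm_num)

theorem continuous_c (j : Fin D.n) : Continuous (D.c j) := (D.differentiable_c j).continuous

theorem continuous_cc (j k : Fin D.n) : Continuous (D.cc j k) :=
  (D.differentiable_fderiv_c j).continuous.clm_apply continuous_const

theorem abs_cc_le (j k : Fin D.n) (x : Fin D.n → ℝ) : |D.cc j k x| ≤ D.M :=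
  ((fderiv ℝ (D.c j) x).le_opNorm _).trans
    ((mul_le_of_le_one_right (norm_nonneg _) (D.norm_single_one_le k)).trans
      (D.norm_fderiv_c_le j x))

theorem abs_c_sub_le (j : Fin D.n) (x y : Fin D.n → ℝ) :
    |D.c j y - D.c j x| ≤ D.M * ‖y - x‖ :=
  convex_univ.norm_image_sub_le_of_norm_fderiv_le (fun z _ => D.differentiable_c j z)
    (fun z _ => D.norm_fderiv_c_le j z) (mem_univ x) (mem_univ y)

theorem fderiv_c_apply (j : Fin D.n) (x v : Fin D.n → ℝ) :
    fderiv ℝ (D.c j) x v = ∑ k, D.cc j k x * v k := by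
  conv_lhs => rw [← Finset.univ_sum_single v]
  rw [map_sum]
  refine Finset.sum_congr rfl fun k _ => ?_
  have : (Pi.single k (v k) : Fin D.n → ℝ) = v k • Pi.single k 1 := by
    rw [← Pi.single_smul']; simp
  rw [this, map_smul, smul_eq_mul, mul_comm]; rfl

/-- Second-order Taylor estimate, from the mean value inequality on the segment. Here the bound on
the third derivative of `g` enters. -/
theorem abs_c_sub_sub_le (j : Fin D.n) (x y : Fin D.n → ℝ) :
    |D.c j y - D.c j x - ∑ k, D.cc j k x * (y k - x k)| ≤ D.M * ‖y - x‖ ^ 2 := by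
  have h1 : ∑ k, D.cc j k x * (y k - x k) = fderiv ℝ (D.c j) x (y - x) := by
    rw [fderiv_c_apply]; rfl
  rw [h1, pow_two, ← mul_assoc]
  refine (convex_segment x y).norm_image_sub_le_of_norm_fderiv_le'
    (fun z _ => D.differentiable_c j z) (fun z hz => ?_) (left_mem_segment ℝ x y)
    (right_mem_segment ℝ x y)
  refine (convex_univ.norm_image_sub_le_of_norm_fderiv_le
    (fun z _ => D.differentiable_fderiv_c j z) (fun z _ => D.norm_fderiv_fderiv_c_le j z)
    (mem_univ x) (mem_univ z)).trans ?_
  refine mul_le_mul_of_nonneg_left ?_ D.M_nonneg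
  obtain ⟨θ, ⟨h0, h1⟩, rfl⟩ := (segment_eq_image' ℝ x y).subset hz
  rw [add_sub_cancel_left, norm_smul, Real.norm_of_nonneg h0]
  exact mul_le_of_le_one_left (norm_nonneg _) h1

/-- The bounded derivation `A ↦ i [Bⱼ, A]`. -/
def ad (j : Fin D.n) : X →L[ℂ] X :=
  Complex.I • (ContinuousLinearMap.mul ℂ X (D.B j) - (ContinuousLinearMap.mul ℂ X).flip (D.B j))

theorem ad_apply (j : Fin D.n) (A : X) : D.ad j A = Complex.I • (D.B j * A - A * D.B j) := rfl

/-- The real coordinates `φ(Bₖ)` of a functional `φ`. -/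
def coord (φ : X →L[ℂ] ℂ) (k : Fin D.n) : ℝ := (φ (D.B k)).re

/-- A Lipschitz constant of the coordinates. -/
def β : ℝ := ∑ k, ‖D.B k‖

/-- A growth constant of the vector field. -/
def K : ℝ := ∑ j, D.M * ‖D.ad j‖

theorem β_nonneg : 0 ≤ D.β := Finset.sum_nonneg fun _ _ => norm_nonneg _

theorem K_nonneg : 0 ≤ D.K := Finset.sum_nonneg fun _ _ => mul_nonneg D.M_nonneg (norm_nonneg _)

theorem norm_coord_sub_le (φ ψ : X →L[ℂ] ℂ) :
    ‖D.coord φ - D.coord ψ‖ ≤ D.β * ‖φ - ψ‖ := by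
  refine (pi_norm_le_iff_of_nonneg (mul_nonneg D.β_nonneg (norm_nonneg _))).2 fun k => ?_
  have h1 : (D.coord φ - D.coord ψ) k = ((φ - ψ) (D.B k)).re := by simp [coord]
  rw [h1, mul_comm]
  exact (Complex.abs_re_le_norm _).trans (((φ - ψ).le_opNorm _).trans
    (mul_le_mul_of_nonneg_left (Finset.single_le_sum (f := fun k => ‖D.B k‖)
      (fun _ _ => norm_nonneg _) (Finset.mem_univ k)) (norm_nonneg _)))

theorem norm_coord_sub_sq_le (φ ψ : X →L[ℂ] ℂ) :
    ‖D.coord φ - D.coord ψ‖ ^ 2 ≤ D.β ^ 2 * ‖φ - ψ‖ ^ 2 := by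
  rw [← mul_pow]
  exact pow_le_pow_left₀ (norm_nonneg _) (D.norm_coord_sub_le φ ψ) 2

/-- The vector field on the dual space that generates the flow. -/
def field (φ : X →L[ℂ] ℂ) : X →L[ℂ] ℂ := ∑ j, (D.c j (D.coord φ) : ℂ) • φ.comp (D.ad j)

theorem norm_c_smul_comp_le (j : Fin D.n) (x : Fin D.n → ℝ) (φ : X →L[ℂ] ℂ) :
    ‖(D.c j x : ℂ) • φ.comp (D.ad j)‖ ≤ D.M * ‖D.ad j‖ * ‖φ‖ := by
  rw [norm_smul, Complex.norm_real, mul_assoc, mul_comm ‖D.ad j‖]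
  exact mul_le_mul (D.abs_c_le j _) (φ.opNorm_comp_le _) (norm_nonneg _) D.M_nonneg

theorem norm_field_le (φ : X →L[ℂ] ℂ) : ‖D.field φ‖ ≤ D.K * ‖φ‖ := by
  rw [K, Finset.sum_mul]
  exact norm_sum_le_of_le _ fun j _ => D.norm_c_smul_comp_le j _ φ

/-- The variation of the coefficients is multiplied by `φ` alone, so `ψ` may be arbitrary.
Uniqueness can thus compare a curve of states with any other trajectory. -/
theorem norm_field_sub_le {R : ℝ} {φ ψ : X →L[ℂ] ℂ} (hφ : ‖φ‖ ≤ R) :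
    ‖D.field φ - D.field ψ‖ ≤ D.K * (D.β * R + 1) * ‖φ - ψ‖ := by
  have hR : 0 ≤ R := (norm_nonneg _).trans hφ
  rw [field, field, ← Finset.sum_sub_distrib, K, Finset.sum_mul, Finset.sum_mul]
  refine norm_sum_le_of_le _ fun j _ => ?_
  have h1 : (D.c j (D.coord φ) : ℂ) • φ.comp (D.ad j) - (D.c j (D.coord ψ) : ℂ) • ψ.comp (D.ad j)
      = ((D.c j (D.coord φ) - D.c j (D.coord ψ) : ℝ) : ℂ) • φ.comp (D.ad j)
        + (D.c j (D.coord ψ) : ℂ) • (φ - ψ).comp (D.ad j) := by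
    ext A
    simp
    ring
  rw [h1]
  refine (norm_add_le _ _).trans ?_
  have h2 : ‖((D.c j (D.coord φ) - D.c j (D.coord ψ) : ℝ) : ℂ) • φ.comp (D.ad j)‖ ≤
      (D.M * (D.β * ‖φ - ψ‖)) * (R * ‖D.ad j‖) := by
    rw [norm_smul, Complex.norm_real]
    refine mul_le_mul ((D.abs_c_sub_le j _ _).trans
      (mul_le_mul_of_nonneg_left (D.norm_coord_sub_le φ ψ) D.M_nonneg)) ?_ (norm_nonneg _) ?_
    · exact (φ.opNorm_comp_le _).trans (mul_le_mul_of_nonneg_right hφ (norm_nonneg _))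
    · exact mul_nonneg D.M_nonneg (mul_nonneg D.β_nonneg (norm_nonneg _))
  have h3 := D.norm_c_smul_comp_le j (D.coord ψ) (φ - ψ)
  calc _ ≤ (D.M * (D.β * ‖φ - ψ‖)) * (R * ‖D.ad j‖) + D.M * ‖D.ad j‖ * ‖φ - ψ‖ := add_le_add h2 h3
    _ = _ := by ring

/-- The linearization of the vector field. -/
def linField (φ η : X →L[ℂ] ℂ) : X →L[ℂ] ℂ :=
  ∑ j, ((D.c j (D.coord φ) : ℂ) • η.comp (D.ad j) +
    (∑ k, (D.cc j k (D.coord φ) : ℂ) * η (D.B k)) • φ.comp (D.ad j))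

theorem norm_sum_cc_mul_le (j : Fin D.n) (x : Fin D.n → ℝ) (η : X →L[ℂ] ℂ) :
    ‖∑ k, (D.cc j k x : ℂ) * η (D.B k)‖ ≤ D.M * D.β * ‖η‖ := by
  rw [β, Finset.mul_sum, Finset.sum_mul]
  refine norm_sum_le_of_le _ fun k _ => ?_
  rw [norm_mul, Complex.norm_real, mul_assoc, mul_comm ‖D.B k‖]
  exact mul_le_mul (D.abs_cc_le j k x) (η.le_opNorm _) (norm_nonneg _) D.M_nonneg

theorem norm_linField_le {φ η : X →L[ℂ] ℂ} (hφ : ‖φ‖ ≤ 1) :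
    ‖D.linField φ η‖ ≤ D.K * (D.β + 1) * ‖η‖ := by
  rw [linField, K, Finset.sum_mul, Finset.sum_mul]
  refine norm_sum_le_of_le _ fun j _ => (norm_add_le _ _).trans ?_
  have h1 : ‖(∑ k, (D.cc j k (D.coord φ) : ℂ) * η (D.B k)) • φ.comp (D.ad j)‖ ≤
      D.M * D.β * ‖η‖ * ‖D.ad j‖ := by
    rw [norm_smul]
    refine mul_le_mul (D.norm_sum_cc_mul_le j _ η) ?_ (norm_nonneg _)
      (mul_nonneg (mul_nonneg D.M_nonneg D.β_nonneg) (norm_nonneg _))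
    exact (φ.opNorm_comp_le _).trans (mul_le_of_le_one_left (norm_nonneg _) hφ)
  calc _ ≤ D.M * ‖D.ad j‖ * ‖η‖ + D.M * D.β * ‖η‖ * ‖D.ad j‖ :=
        add_le_add (D.norm_c_smul_comp_le j _ η) h1
    _ = _ := by ring

theorem linField_sub (φ η θ : X →L[ℂ] ℂ) :
    D.linField φ (η - θ) = D.linField φ η - D.linField φ θ := by
  rw [linField, linField, linField, ← Finset.sum_sub_distrib]
  refine Finset.sum_congr rfl fun j _ => ?_
  have h : ∑ k, (D.cc j k (D.coord φ) : ℂ) * (η - θ) (D.B k) =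
      ∑ k, (D.cc j k (D.coord φ) : ℂ) * η (D.B k) -
        ∑ k, (D.cc j k (D.coord φ) : ℂ) * θ (D.B k) := by
    rw [← Finset.sum_sub_distrib]
    exact Finset.sum_congr rfl fun k _ => by rw [sub_apply, mul_sub]
  rw [h]
  ext A
  simp only [add_apply, sub_apply, smul_apply, ContinuousLinearMap.comp_apply, smul_eq_mul]
  ring

theorem linField_smul (φ η : X →L[ℂ] ℂ) (z : ℂ) :
    D.linField φ (z • η) = z • D.linField φ η := by
  rw [linField, linField, Finset.smul_sum]
  refine Finset.sum_congr rfl fun j _ => ?_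
  simp only [smul_apply, smul_eq_mul, mul_left_comm _ z, ← Finset.mul_sum,
    ContinuousLinearMap.smul_comp, smul_add, mul_smul, smul_comm _ z]

/-- `coord` takes real parts, whereas `linField` is kept complex linear; the two match only in
directions that are real on each `B k`, such as differences of states. What remains is the Taylor
remainder of the coefficients and a product of two first-order terms. -/
theorem norm_field_sub_linField_le {φ ψ : X →L[ℂ] ℂ} (hφ : ‖φ‖ ≤ 1)
    (hreal : ∀ k, ((φ - ψ) (D.B k)).im = 0) :
    ‖D.field φ - D.field ψ - D.linField ψ (φ - ψ)‖ ≤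
      D.K * (D.β ^ 2 + D.β) * ‖φ - ψ‖ ^ 2 := by
  rw [field, field, linField, ← Finset.sum_sub_distrib, ← Finset.sum_sub_distrib, K,
    Finset.sum_mul, Finset.sum_mul]
  refine norm_sum_le_of_le _ fun j _ => ?_
  have hre : ∀ k, (φ - ψ) (D.B k) = ((D.coord φ k - D.coord ψ k : ℝ) : ℂ) := fun k =>
    Complex.ext (by simp [coord]) (by simpa using hreal k)
  set s : ℝ := ∑ k, D.cc j k (D.coord ψ) * (D.coord φ k - D.coord ψ k) with hs
  have hsum : ∑ k, (D.cc j k (D.coord ψ) : ℂ) * (φ - ψ) (D.B k) = (s : ℂ) := by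
    rw [hs, Complex.ofReal_sum]
    exact Finset.sum_congr rfl fun k _ => by rw [hre, Complex.ofReal_mul]
  have hsn : |s| ≤ D.M * D.β * ‖φ - ψ‖ := by
    rw [← Real.norm_eq_abs, ← Complex.norm_real, ← hsum]; exact D.norm_sum_cc_mul_le j _ _
  rw [hsum]
  have h1 : (D.c j (D.coord φ) : ℂ) • φ.comp (D.ad j) - (D.c j (D.coord ψ) : ℂ) • ψ.comp (D.ad j)
      - ((D.c j (D.coord ψ) : ℂ) • (φ - ψ).comp (D.ad j) + (s : ℂ) • ψ.comp (D.ad j))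
      = ((D.c j (D.coord φ) - D.c j (D.coord ψ) - s : ℝ) : ℂ) • φ.comp (D.ad j)
        + (s : ℂ) • (φ - ψ).comp (D.ad j) := by
    ext A
    simp
    ring
  rw [h1]
  refine (norm_add_le _ _).trans ?_
  have h2 : ‖((D.c j (D.coord φ) - D.c j (D.coord ψ) - s : ℝ) : ℂ) • φ.comp (D.ad j)‖ ≤
      (D.M * (D.β ^ 2 * ‖φ - ψ‖ ^ 2)) * ‖D.ad j‖ := by
    rw [norm_smul, Complex.norm_real]
    refine mul_le_mul ((D.abs_c_sub_sub_le j _ _).trans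
      (mul_le_mul_of_nonneg_left (D.norm_coord_sub_sq_le φ ψ) D.M_nonneg)) ?_ (norm_nonneg _) ?_
    · exact (φ.opNorm_comp_le _).trans (mul_le_of_le_one_left (norm_nonneg _) hφ)
    · exact mul_nonneg D.M_nonneg (by positivity)
  have h3 : ‖(s : ℂ) • (φ - ψ).comp (D.ad j)‖ ≤
      D.M * D.β * ‖φ - ψ‖ * (‖φ - ψ‖ * ‖D.ad j‖) := by
    rw [norm_smul, Complex.norm_real]
    exact mul_le_mul hsn ((φ - ψ).opNorm_comp_le _) (norm_nonneg _)
      (mul_nonneg (mul_nonneg D.M_nonneg D.β_nonneg) (norm_nonneg _))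
  calc _ ≤ _ := add_le_add h2 h3
    _ = _ := by ring

/-- The Hamiltonian function. -/
def hamiltonian : C(StateSpace X, ℂ) where
  toFun ρ := (D.g (D.coord ρ.toDual) : ℂ)
  continuous_toFun := by
    refine Complex.continuous_ofReal.comp (D.contDiff.continuous.comp (continuous_pi fun k => ?_))
    exact Complex.continuous_re.comp (gelfandHat (D.B k)).continuous

theorem continuous_coord_toDual : Continuous fun ρ : StateSpace X => D.coord ρ.toDual :=
  continuous_pi fun k => Complex.continuous_re.comp (gelfandHat (D.B k)).continuous

/-- The gradient of the Hamiltonian. -/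
def gradient : C(StateSpace X, X) where
  toFun ρ := ∑ j, (D.c j (D.coord ρ.toDual) : ℂ) • (D.B j - ρ.1 (D.B j) • (1 : X))
  continuous_toFun := by
    refine continuous_finsetSum _ fun j _ => ?_
    refine (Complex.continuous_ofReal.comp
      ((D.continuous_c j).comp D.continuous_coord_toDual)).smul ?_
    exact continuous_const.sub ((gelfandHat (D.B j)).continuous.smul continuous_const)

theorem fderiv_g_apply (x v : Fin D.n → ℝ) :
    fderiv ℝ D.g x v = ∑ k, D.c k x * v k := by
  conv_lhs => rw [← Finset.univ_sum_single v]
  rw [map_sum]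
  refine Finset.sum_congr rfl fun k _ => ?_
  have : (Pi.single k (v k) : Fin D.n → ℝ) = v k • Pi.single k 1 := by
    rw [← Pi.single_smul']; simp
  rw [this, map_smul, smul_eq_mul, mul_comm]; rfl

/-- The derivative of `g` towards `υ` involves `υ(Bⱼ) - ρ(Bⱼ)`. Since `υ(1) = 1`, this is the value
of `υ` at `Bⱼ - ρ(Bⱼ) 1`. -/
theorem hasStateGradient_hamiltonian : HasStateGradient D.hamiltonian D.gradient := by
  intro ρ υ
  set x := D.coord ρ.toDual
  set v := D.coord υ.toDual - x with hv
  have hmix : ∀ l : I, D.coord (ρ.mix υ l).toDual = x + (l : ℝ) • v := fun l => by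
    ext k
    simp only [coord, StateSpace.toDual_apply, StateSpace.mix_apply, Pi.add_apply, Pi.smul_apply,
      hv, Pi.sub_apply, x, smul_eq_mul]
    simp
    ring
  have hd : HasDerivAt (fun s : ℝ => D.g (x + s • v)) (fderiv ℝ D.g x v) 0 := by
    have h1 : HasDerivAt (fun s : ℝ => x + s • v) v 0 := by
      simpa using ((hasDerivAt_id (0 : ℝ)).smul_const v).const_add x
    have h2 : HasFDerivAt D.g (fderiv ℝ D.g x) (x + (0 : ℝ) • v) := by
      rw [zero_smul, add_zero]
      exact (D.contDiff.differentiable (by norm_num) x).hasFDerivAt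
    exact h2.comp_hasDerivAt 0 h1
  have hval : υ.1 (D.gradient ρ) = ((fderiv ℝ D.g x v : ℝ) : ℂ) := by
    rw [fderiv_g_apply]
    simp only [gradient, ContinuousMap.coe_mk, map_sum, map_smul, map_sub, υ.apply_one]
    push_cast
    refine Finset.sum_congr rfl fun j _ => ?_
    simp only [hv, Pi.sub_apply, x, coord, StateSpace.toDual_apply, smul_eq_mul, mul_one]
    push_cast
    rw [υ.ofReal_re_apply (D.isSelfAdjoint j), ρ.ofReal_re_apply (D.isSelfAdjoint j)]
  rw [hval]
  have h3 := (hd.tendsto_slope.mono_left (nhdsGT_le_nhdsNE 0)).comp tendsto_coe_nhdsGT_zero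
  refine ((Complex.continuous_ofReal.tendsto _).comp h3).congr fun l => ?_
  simp only [Function.comp, slope_def_field, hamiltonian, ContinuousMap.coe_mk, hmix, zero_smul,
    add_zero, sub_zero]
  push_cast
  rw [div_eq_inv_mul]

/-- The multiples of the unit in the gradient are central and drop out of the commutator. -/
theorem quantumGenerator_hamiltonian (ρ : StateSpace X) :
    quantumGenerator D.hamiltonian ρ = ∑ j, (D.c j (D.coord ρ.toDual) : ℂ) • D.ad j := by
  ext A
  rw [quantumGenerator, D.hasStateGradient_hamiltonian.stateGradient_eq]
  simp only [gradient, ContinuousMap.coe_mk, smul_apply,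
    sub_apply, ContinuousLinearMap.mul_apply', ContinuousLinearMap.flip_apply,
    sum_apply, ad_apply, Finset.sum_mul, Finset.mul_sum,
    ← Finset.sum_sub_distrib, Finset.smul_sum]
  refine Finset.sum_congr rfl fun j _ => ?_
  rw [smul_mul_assoc, mul_smul_comm, ← smul_sub, smul_comm]
  congr 2
  rw [sub_mul, mul_sub, smul_mul_assoc, mul_smul_comm, one_mul, mul_one]
  abel

theorem comp_quantumGenerator (ρ : StateSpace X) :
    ρ.toDual.comp (quantumGenerator D.hamiltonian ρ) = D.field ρ.toDual := by
  ext A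
  rw [quantumGenerator_hamiltonian]
  simp [field]

end CylindricalData

/-! ### Inner evolutions -/

section Inner

variable {X : Type*} [CStarAlgebra X]

/-- The bounded derivation `A ↦ i [a, A]`, depending linearly on `a`. -/
def innerDer (X : Type*) [CStarAlgebra X] : X →L[ℂ] X →L[ℂ] X :=
  Complex.I • (ContinuousLinearMap.mul ℂ X - (ContinuousLinearMap.mul ℂ X).flip)

theorem innerDer_apply (a A : X) : innerDer X a A = Complex.I • (a * A - A * a) := rfl

theorem hasDerivAt_comp_left {W Y Z : Type*} [NormedAddCommGroup W] [NormedSpace ℂ W]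
    [NormedAddCommGroup Y] [NormedSpace ℂ Y] [NormedAddCommGroup Z] [NormedSpace ℂ Z]
    (φ : Y →L[ℂ] Z) {T : ℝ → (W →L[ℂ] Y)} {T' : W →L[ℂ] Y} {t : ℝ} (hT : HasDerivAt T T' t) :
    HasDerivAt (fun t => φ.comp (T t)) (φ.comp T') t :=
  ((ContinuousLinearMap.compL ℂ W Y Z φ).restrictScalars ℝ).hasFDerivAt.comp_hasDerivAt t hT

/-- Grönwall for a bounded linear equation. The codomain is arbitrary so that the lemma covers both
operators on `X` and functionals. -/
theorem comp_evolution_unique {Y : Type*} [NormedAddCommGroup Y] [NormedSpace ℂ Y]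
    {Q : ℝ → (X →L[ℂ] X)} {K : ℝ} (hQ : ∀ t, ‖Q t‖ ≤ K) {S T : ℝ → (X →L[ℂ] Y)} {s : ℝ}
    (hS : ∀ t, HasDerivAt S ((S t).comp (Q t)) t) (hT : ∀ t, HasDerivAt T ((T t).comp (Q t)) t)
    (h : S s = T s) (t : ℝ) : S t = T t := by
  refine eq_of_hasDerivAt_of_norm_sub_le (a := s) (K := K) (fun t _ => hS t) (fun t _ => hT t) h
    fun t _ => ?_
  rw [← ContinuousLinearMap.sub_comp, mul_comm]
  exact ((S t - T t).opNorm_comp_le _).trans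
    (mul_le_mul_of_nonneg_left (hQ t) (norm_nonneg _))

/-- The evolution is conjugation by the solution of `u' = u (i a)`; self-adjointness of `a` turns
the product rule into the commutator. -/
theorem exists_inner_evolution {a : ℝ → X} (ha : Continuous a) (hsa : ∀ t, IsSelfAdjoint (a t))
    (s : ℝ) : ∃ T : ℝ → (X →L[ℂ] X), T s = ContinuousLinearMap.id ℂ X ∧
      (∀ t, HasDerivAt T ((T t).comp (innerDer X (a t))) t) ∧
      ∀ t, ∃ u : X, u * star u = 1 ∧ ∀ A, T t A = u * A * star u := by
  obtain ⟨u, hus, hu⟩ := exists_forall_hasDerivAt_linear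
    (L := fun t => (ContinuousLinearMap.mul ℝ X).flip (Complex.I • a t))
    ((ContinuousLinearMap.mul ℝ X).flip.continuous.comp (ha.const_smul Complex.I)) s 1
  have hu : ∀ t, HasDerivAt u (u t * (Complex.I • a t)) t := hu
  let T : ℝ → (X →L[ℂ] X) := fun t => ContinuousLinearMap.mulLeftRight ℂ X (u t) (star (u t))
  have hTA : ∀ t A, T t A = u t * A * star (u t) := fun t A => rfl
  have hTs : T s = ContinuousLinearMap.id ℂ X := by
    ext A; rw [hTA, hus]; simp
  have hT : ∀ t, HasDerivAt T ((T t).comp (innerDer X (a t))) t := fun t => by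
    let b : X →L[ℝ] X →L[ℝ] (X →L[ℂ] X) :=
      (ContinuousLinearMap.restrictScalarsL ℂ X (X →L[ℂ] X) ℝ ℝ).comp
        ((ContinuousLinearMap.mulLeftRight ℂ X).restrictScalars ℝ)
    have h1 : HasDerivAt T (b (u t) (star (u t * (Complex.I • a t))) +
        b (u t * (Complex.I • a t)) (star (u t))) t :=
      b.hasDerivAt_of_bilinear (fun _ => hu t) (fun _ => (hu t).star)
    convert h1 using 1
    ext A
    change u t * (Complex.I • (a t * A - A * a t)) * star (u t) =
      u t * A * star (u t * (Complex.I • a t)) + u t * (Complex.I • a t) * A * star (u t)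
    rw [star_mul, star_smul, (hsa t).star_eq]
    simp only [mul_smul_comm, smul_mul_assoc, mul_sub, sub_mul, smul_sub, Complex.star_def,
      Complex.conj_I, neg_smul, mul_assoc, mul_neg, neg_mul]
    abel
  refine ⟨T, hTs, hT, fun t => ⟨u t, ?_, hTA t⟩⟩
  -- A derivation kills the unit, so `T t 1 = u t * star (u t)` is constant.
  have h1 : ∀ t, HasDerivAt (fun t => T t 1) 0 t := fun t => by
    have h2 : HasDerivAt (fun t => T t 1) (T t (innerDer X (a t) 1)) t :=
      (((ContinuousLinearMap.apply ℂ X (1 : X)).restrictScalars ℝ).hasFDerivAt.comp_hasDerivAt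
        t (hT t))
    rwa [innerDer_apply, mul_one, one_mul, sub_self, smul_zero, map_zero] at h2
  have h2 := is_const_of_deriv_eq_zero (fun t => (h1 t).differentiableAt)
    (fun t => (h1 t).deriv) t s
  simpa [hTA, hus] using h2

theorem comp_inner_mem_stateSet (ρ : StateSpace X) {T : X →L[ℂ] X} {u : X}
    (hu : u * star u = 1) (hT : ∀ A, T A = u * A * star u) :
    StrongDual.toWeakDual (ρ.toDual.comp T) ∈ stateSet X := by
  refine ⟨fun A => ?_, ?_⟩
  · change 0 ≤ ρ.1 (T (star A * A))
    have : T (star A * A) = star (A * star u) * (A * star u) := by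
      rw [hT, star_mul, star_star]; noncomm_ring
    rw [this]; exact ρ.2.1 _
  · change ρ.1 (T 1) = 1
    rw [hT, mul_one, hu, ρ.apply_one]

end Inner

/-! ### Quantum evolutions along a curve and trajectories in the dual space -/

namespace CylindricalData

variable {X : Type*} [CStarAlgebra X] (D : CylindricalData X)

/-- A representative of the gradient of the Hamiltonian, modulo multiples of the unit. -/
def effective (x : Fin D.n → ℝ) : X := ∑ j, (D.c j x : ℂ) • D.B j

theorem isSelfAdjoint_effective (x : Fin D.n → ℝ) : IsSelfAdjoint (D.effective x) := by
  refine isSelfAdjoint_sum _ fun j _ => ?_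
  rw [Complex.coe_smul]
  exact (IsSelfAdjoint.all (D.c j x)).smul (D.isSelfAdjoint j)

theorem continuous_effective : Continuous D.effective :=
  continuous_finsetSum _ fun j _ =>
    (Complex.continuous_ofReal.comp (D.continuous_c j)).smul continuous_const

theorem innerDer_effective (x : Fin D.n → ℝ) :
    innerDer X (D.effective x) = ∑ j, (D.c j x : ℂ) • D.ad j := by
  simp only [effective, map_sum, map_smul]; rfl

theorem norm_innerDer_effective_le (x : Fin D.n → ℝ) : ‖innerDer X (D.effective x)‖ ≤ D.K := by
  rw [innerDer_effective]
  refine norm_sum_le_of_le _ fun j _ => ?_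
  rw [norm_smul, Complex.norm_real]
  exact mul_le_mul_of_nonneg_right (D.abs_c_le j x) (norm_nonneg _)

theorem comp_innerDer_effective (φ : X →L[ℂ] ℂ) :
    φ.comp (innerDer X (D.effective (D.coord φ))) = D.field φ := by
  rw [innerDer_effective]; ext A; simp [field]

theorem quantumGenerator_eq_innerDer (ρ : StateSpace X) :
    quantumGenerator D.hamiltonian ρ = innerDer X (D.effective (D.coord ρ.toDual)) := by
  rw [quantumGenerator_hamiltonian, innerDer_effective]

theorem existsUnique_isQuantumEvolution (ξ : C(ℝ, StateSpace X)) :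
    ∃! T, IsQuantumEvolution (fun _ => D.hamiltonian) ξ T := by
  have hc : Continuous fun t => D.effective (D.coord (ξ t).toDual) :=
    D.continuous_effective.comp (D.continuous_coord_toDual.comp ξ.continuous)
  choose T hTs hT _ using exists_inner_evolution hc fun t => D.isSelfAdjoint_effective _
  refine ⟨fun t s => T s t, ⟨fun s t => ?_, hTs⟩, fun S hS => ?_⟩
  · rw [quantumGenerator_eq_innerDer]; exact hT s t
  · funext t s
    refine comp_evolution_unique (fun t => D.norm_innerDer_effective_le (D.coord (ξ t).toDual))
      (S := fun t => S t s) (T := T s) (s := s) (fun t => ?_) (hT s) ?_ t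
    · rw [← quantumGenerator_eq_innerDer]; exact hS.1 s t
    · exact (hS.2 s).trans (hTs s).symm

/-- Integral curves of the vector field on the dual space. -/
def IsTrajectory (φ : ℝ → (X →L[ℂ] ℂ)) : Prop := ∀ t, HasDerivAt φ (D.field (φ t)) t

namespace IsTrajectory

variable {D} {φ ψ : ℝ → (X →L[ℂ] ℂ)}

theorem comp_add (hφ : D.IsTrajectory φ) (s : ℝ) : D.IsTrajectory fun t => φ (t + s) := fun t =>
  (hφ (t + s)).comp_add_const t s

theorem norm_sub_le (hφ : D.IsTrajectory φ) (hψ : D.IsTrajectory ψ) (h1 : ∀ t, ‖φ t‖ ≤ 1)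
    (s t : ℝ) : ‖φ t - ψ t‖ ≤ ‖φ s - ψ s‖ * Real.exp (D.K * (D.β * 1 + 1) * |t - s|) := by
  rw [← gronwallBound_ε0]
  exact norm_le_gronwallBound_of_hasDerivAt (u := fun t => φ t - ψ t)
    (fun t _ => (hφ t).sub (hψ t)) le_rfl
    fun t _ => by simpa using D.norm_field_sub_le (ψ := ψ t) (h1 t)

theorem unique (hφ : D.IsTrajectory φ) (hψ : D.IsTrajectory ψ) (h1 : ∀ t, ‖φ t‖ ≤ 1) {s : ℝ}
    (h : φ s = ψ s) (t : ℝ) : φ t = ψ t := by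
  have := hφ.norm_sub_le hψ h1 s t
  rw [h, sub_self, norm_zero, zero_mul] at this
  exact sub_eq_zero.1 (norm_le_zero_iff.1 this)

theorem continuous (hφ : D.IsTrajectory φ) : Continuous φ :=
  continuous_iff_continuousAt.2 fun t => (hφ t).continuousAt

theorem continuous_coord (hφ : D.IsTrajectory φ) : Continuous fun t => D.coord (φ t) :=
  continuous_pi fun k => Complex.continuous_re.comp
    ((ContinuousLinearMap.apply ℂ ℂ (D.B k)).continuous.comp hφ.continuous)

/-- With the coefficients frozen along `φ`, both `φ` and `ρ ∘ T` solve the same linear equation, and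
the inner evolution `T` preserves states. -/
theorem mem_stateSet (hφ : D.IsTrajectory φ) {ρ : StateSpace X} (h0 : φ 0 = ρ.toDual) (t : ℝ) :
    StrongDual.toWeakDual (φ t) ∈ stateSet X := by
  obtain ⟨T, hT0, hT, hTu⟩ := exists_inner_evolution
    (D.continuous_effective.comp hφ.continuous_coord) (fun t => D.isSelfAdjoint_effective _) 0
  obtain ⟨u, hu, huT⟩ := hTu t
  have : φ t = ρ.toDual.comp (T t) := by
    refine comp_evolution_unique (fun t => D.norm_innerDer_effective_le (D.coord (φ t)))
      (S := φ) (T := fun t => ρ.toDual.comp (T t)) (s := 0) (fun t => ?_) (fun t => ?_) ?_ t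
    · rw [comp_innerDer_effective]; exact hφ t
    · exact hasDerivAt_comp_left ρ.toDual (hT t)
    · rw [h0, hT0, ContinuousLinearMap.comp_id]
  rw [this]
  exact comp_inner_mem_stateSet ρ hu huT

end IsTrajectory

/-- The derivative of `ρ ∘ T` is `ρ ∘ T` composed with the generator; self-consistency replaces `ρ ∘
T` by `ξ` and closes the equation. -/
theorem _root_.IsQuantumEvolution.isTrajectory {D : CylindricalData X} {ξ : C(ℝ, StateSpace X)}
    {T : ℝ → ℝ → (X →L[ℂ] X)}
    (hT : IsQuantumEvolution (fun _ => D.hamiltonian) ξ T) {ρ : StateSpace X} {s : ℝ}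
    (hξ : ∀ t A, (ξ t).1 A = ρ.1 (T t s A)) : D.IsTrajectory fun t => (ξ t).toDual := by
  have h1 : ∀ t, (ξ t).toDual = ρ.toDual.comp (T t s) := fun t => by ext A; exact hξ t A
  intro t
  rw [← D.comp_quantumGenerator, h1 t, funext h1]
  exact hasDerivAt_comp_left ρ.toDual (hT.1 s t)

/-! ### The flow -/

/-- The value at `ρ` of a weak-⋆ continuous field of functionals. -/
def ev (ρ : StateSpace X) (Φ : X →L[ℂ] C(StateSpace X, ℂ)) : X →L[ℂ] ℂ :=
  (ContinuousMap.evalCLM ℂ ρ).comp Φ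

theorem ev_apply (ρ : StateSpace X) (Φ : X →L[ℂ] C(StateSpace X, ℂ)) (A : X) :
    ev ρ Φ A = Φ A ρ := rfl

theorem norm_ev_le (ρ : StateSpace X) (Φ : X →L[ℂ] C(StateSpace X, ℂ)) : ‖ev ρ Φ‖ ≤ ‖Φ‖ :=
  ContinuousLinearMap.opNorm_le_bound _ (norm_nonneg _) fun A =>
    ((Φ A).norm_coe_le_norm ρ).trans (Φ.le_opNorm A)

theorem norm_le_of_norm_ev_le {Φ : X →L[ℂ] C(StateSpace X, ℂ)} {r : ℝ} (hr : 0 ≤ r)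
    (h : ∀ ρ, ‖ev ρ Φ‖ ≤ r) : ‖Φ‖ ≤ r :=
  ContinuousLinearMap.opNorm_le_bound _ hr fun A =>
    (ContinuousMap.norm_le _ (by positivity)).2 fun ρ => (ev ρ Φ).le_of_opNorm_le (h ρ) A

/-- The coefficient functions of the vector field along a field of functionals. -/
def coef (j : Fin D.n) (Φ : X →L[ℂ] C(StateSpace X, ℂ)) : C(StateSpace X, ℂ) where
  toFun ρ := (D.c j (D.coord (ev ρ Φ)) : ℂ)
  continuous_toFun := Complex.continuous_ofReal.comp ((D.continuous_c j).comp
    (continuous_pi fun k => Complex.continuous_re.comp (Φ (D.B k)).continuous))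

/-- The vector field on weak-⋆ continuous fields of functionals. -/
def bigField (Φ : X →L[ℂ] C(StateSpace X, ℂ)) : X →L[ℂ] C(StateSpace X, ℂ) :=
  ∑ j, (ContinuousLinearMap.mul ℂ C(StateSpace X, ℂ) (D.coef j Φ)).comp (Φ.comp (D.ad j))

theorem ev_bigField (ρ : StateSpace X) (Φ : X →L[ℂ] C(StateSpace X, ℂ)) :
    ev ρ (D.bigField Φ) = D.field (ev ρ Φ) := by
  ext A
  rw [ev_apply, bigField, field, sum_apply, ContinuousMap.sum_apply, sum_apply]
  rfl

theorem ev_sub (ρ : StateSpace X) (Φ Ψ : X →L[ℂ] C(StateSpace X, ℂ)) :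
    ev ρ (Φ - Ψ) = ev ρ Φ - ev ρ Ψ := rfl

/-- All initial states are treated at once: the growth and Lipschitz bounds of `field` are uniform
in `ρ` and pass to `bigField` through `ev`. -/
theorem exists_flow : ∃ Φ : ℝ → (X →L[ℂ] C(StateSpace X, ℂ)), Φ 0 = gelfandHatCLM X ∧
    ∀ t, HasDerivAt Φ (D.bigField (Φ t)) t := by
  refine exists_forall_hasDerivAt_of_linear_growth (F := fun _ Φ => D.bigField Φ)
    (fun _ => continuous_const) (fun T R => ⟨Real.toNNReal (D.K * (D.β * R + 1)), fun t _ => ?_⟩)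
    (fun T => ⟨D.K, D.K_nonneg, fun t _ Φ => ?_⟩) _
  · refine LipschitzOnWith.of_dist_le_mul fun Φ hΦ Ψ _ => ?_
    rw [mem_closedBall_zero_iff] at hΦ
    have hR : 0 ≤ R := (norm_nonneg _).trans hΦ
    have hC : 0 ≤ D.K * (D.β * R + 1) := by
      have := D.K_nonneg
      have := D.β_nonneg
      positivity
    rw [dist_eq_norm, dist_eq_norm, Real.coe_toNNReal _ hC]
    refine norm_le_of_norm_ev_le (by positivity) fun ρ => ?_
    rw [ev_sub, ev_bigField, ev_bigField]
    refine (D.norm_field_sub_le ((norm_ev_le ρ Φ).trans hΦ)).trans ?_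
    rw [← ev_sub]
    exact mul_le_mul_of_nonneg_left (norm_ev_le ρ _) hC
  · refine norm_le_of_norm_ev_le (mul_nonneg D.K_nonneg (norm_nonneg _)) fun ρ => ?_
    rw [ev_bigField]
    exact (D.norm_field_le _).trans (mul_le_mul_of_nonneg_left (norm_ev_le ρ _) D.K_nonneg)

/-- The flow as a curve of weak-⋆ continuous fields of functionals. -/
def Phi : ℝ → (X →L[ℂ] C(StateSpace X, ℂ)) := D.exists_flow.choose

theorem Phi_zero : D.Phi 0 = gelfandHatCLM X := D.exists_flow.choose_spec.1

theorem hasDerivAt_Phi (t : ℝ) : HasDerivAt D.Phi (D.bigField (D.Phi t)) t :=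
  D.exists_flow.choose_spec.2 t

theorem continuous_Phi : Continuous D.Phi :=
  continuous_of_forall_hasDerivAt (Y := X →L[ℂ] C(StateSpace X, ℂ)) (u := D.Phi) D.hasDerivAt_Phi

theorem isTrajectory_ev_Phi (ρ : StateSpace X) : D.IsTrajectory fun t => ev ρ (D.Phi t) :=
  fun t => by
    rw [← ev_bigField]
    exact hasDerivAt_comp_left (ContinuousMap.evalCLM ℂ ρ) (D.hasDerivAt_Phi t)

theorem ev_Phi_zero (ρ : StateSpace X) : ev ρ (D.Phi 0) = ρ.toDual := by rw [Phi_zero]; rfl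

/-- The flow on states. -/
def flow (t : ℝ) (ρ : StateSpace X) : StateSpace X :=
  ⟨StrongDual.toWeakDual (ev ρ (D.Phi t)),
    (D.isTrajectory_ev_Phi ρ).mem_stateSet (D.ev_Phi_zero ρ) t⟩

theorem flow_apply (t : ℝ) (ρ : StateSpace X) (A : X) : (D.flow t ρ).1 A = D.Phi t A ρ := rfl

theorem isTrajectory_flow (ρ : StateSpace X) : D.IsTrajectory fun t => (D.flow t ρ).toDual :=
  D.isTrajectory_ev_Phi ρ

theorem flow_zero (ρ : StateSpace X) : D.flow 0 ρ = ρ :=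
  StateSpace.toDual_injective (D.ev_Phi_zero ρ)

theorem flow_flow (s t : ℝ) (ρ : StateSpace X) : D.flow t (D.flow s ρ) = D.flow (t + s) ρ := by
  refine StateSpace.toDual_injective ((D.isTrajectory_flow (D.flow s ρ)).unique
    ((D.isTrajectory_flow ρ).comp_add s) (fun t => StateSpace.norm_toDual_le _) (s := 0) ?_ t)
  rw [flow_zero, zero_add]

theorem continuous_flow : Continuous fun p : ℝ × StateSpace X => D.flow p.1 p.2 := by
  rw [StateSpace.continuous_iff_apply]
  intro A
  simp only [flow_apply]
  have : Continuous fun p : ℝ × StateSpace X => D.Phi p.1 A :=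
    (D.continuous_Phi.comp continuous_fst).clm_apply continuous_const
  exact continuous_eval.comp (this.prodMk continuous_snd)

/-- The flow at a fixed time as a homeomorphism. -/
def flowHomeomorph (t : ℝ) : StateSpace X ≃ₜ StateSpace X where
  toFun := D.flow t
  invFun := D.flow (-t)
  left_inv ρ := by rw [flow_flow, neg_add_cancel, flow_zero]
  right_inv ρ := by rw [flow_flow, add_neg_cancel, flow_zero]
  continuous_toFun := D.continuous_flow.comp (continuous_const.prodMk continuous_id)
  continuous_invFun := D.continuous_flow.comp (continuous_const.prodMk continuous_id)

/-- The two-parameter flow family `ϖ`. -/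
def flowFamily : C(ℝ × ℝ, C(StateSpace X, StateSpace X)) :=
  ContinuousMap.curry ⟨fun p => D.flow (p.1.2 - p.1.1) p.2,
    D.continuous_flow.comp (by fun_prop : Continuous fun p : (ℝ × ℝ) × StateSpace X =>
      (p.1.2 - p.1.1, p.2))⟩

theorem isSelfConsistentFlow_flowFamily :
    IsSelfConsistentFlow (fun _ => D.hamiltonian) D.flowFamily := by
  refine ⟨fun p => (D.flowHomeomorph (p.2 - p.1)).isHomeomorph, fun s ρ => ?_⟩
  let ξ : C(ℝ, StateSpace X) := ⟨fun t => D.flow (t - s) ρ,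
    D.continuous_flow.comp (by fun_prop : Continuous fun t : ℝ => (t - s, ρ))⟩
  obtain ⟨T, hT, -⟩ := D.existsUnique_isQuantumEvolution ξ
  refine ⟨ξ, T, fun t => rfl, hT, fun t A => ?_⟩
  -- Both sides solve the linear equation with coefficients frozen along `ξ`, and they agree at time
  -- `s`.
  have h : (ξ t).toDual = ρ.toDual.comp (T t s) := by
    refine comp_evolution_unique (fun t => D.norm_innerDer_effective_le (D.coord (ξ t).toDual))
      (S := fun t => (ξ t).toDual) (T := fun t => ρ.toDual.comp (T t s)) (s := s)
      (fun t => ?_) (fun t => ?_) ?_ t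
    · rw [comp_innerDer_effective]
      have := (D.isTrajectory_flow ρ).comp_add (-s) t
      simp only [← sub_eq_add_neg] at this
      exact this
    · rw [← quantumGenerator_eq_innerDer]
      exact hasDerivAt_comp_left ρ.toDual (hT.1 s t)
    · rw [hT.2, ContinuousLinearMap.comp_id]
      change (D.flow (s - s) ρ).toDual = _
      rw [sub_self, flow_zero]
  exact DFunLike.congr_fun h A

theorem eq_flowFamily {ϖ : C(ℝ × ℝ, C(StateSpace X, StateSpace X))}
    (h : IsSelfConsistentFlow (fun _ => D.hamiltonian) ϖ) : ϖ = D.flowFamily := by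
  ext1 p
  obtain ⟨s, t⟩ := p
  ext1 ρ
  obtain ⟨ξ, T, hξ, hT, hϖ⟩ := h.2 s ρ
  have hT' := hT.isTrajectory (ρ := ρ) (s := s) fun t A => by rw [hξ, hϖ]
  rw [← hξ t]
  refine StateSpace.toDual_injective (hT'.unique ((D.isTrajectory_flow ρ).comp_add (-s))
    (fun t => StateSpace.norm_toDual_le _) (s := s) ?_ t)
  rw [add_neg_cancel, flow_zero]
  ext A
  rw [StateSpace.toDual_apply, hξ, hϖ, hT.2]
  rfl

end CylindricalData

/-! ### Differentiability of the flow in the initial state -/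

/-- The right-hand side is a norm-continuous family of bounded operators applied to `W`. In the
application `C` is `C(E; ℂ)`, acting by `S` on `N = C(E; X)`. -/
theorem exists_linear_family {X C N ι κ : Type*} [NormedAddCommGroup X] [NormedSpace ℂ X]
    [NormedAddCommGroup C] [NormedSpace ℂ C] [NormedAddCommGroup N] [NormedSpace ℂ N]
    [CompleteSpace N] [Fintype ι] [Fintype κ] (S : C →L[ℂ] N →L[ℂ] N) (ad : ι → X →L[ℂ] X)
    (B : κ → X) {a : ι → ℝ → C} (ha : ∀ j, Continuous (a j)) {R : ι → κ → ℝ → (X →L[ℂ] C)}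
    (hR : ∀ j k, Continuous (R j k)) (W₀ : X →L[ℂ] N) :
    ∃ W : ℝ → (X →L[ℂ] N), W 0 = W₀ ∧ ∀ t, HasDerivAt W
      (∑ j, ((S (a j t)).comp ((W t).comp (ad j)) +
        ∑ k, (S.flip (W t (B k))).comp (R j k t))) t := by
  let L : ℝ → ((X →L[ℂ] N) →L[ℂ] (X →L[ℂ] N)) := fun t =>
    ∑ j, ((ContinuousLinearMap.compL ℂ X N N (S (a j t))).comp
        ((ContinuousLinearMap.compL ℂ X X N).flip (ad j)) +
      ∑ k, ((ContinuousLinearMap.compL ℂ X C N).flip (R j k t)).comp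
        (S.flip.comp (ContinuousLinearMap.apply ℂ N (B k))))
  have hL : Continuous L := by
    refine continuous_finsetSum _ fun j _ => ?_
    refine Continuous.add ?_ (continuous_finsetSum _ fun k _ => ?_)
    · exact (((ContinuousLinearMap.compL ℂ X N N).continuous.comp
        (S.continuous.comp (ha j)))).clm_comp continuous_const
    · exact ((ContinuousLinearMap.compL ℂ X C N).flip.continuous.comp (hR j k)).clm_comp
        continuous_const
  have hL' : Continuous fun t => (L t).restrictScalars ℝ :=
    (ContinuousLinearMap.restrictScalarsL ℂ (X →L[ℂ] N) (X →L[ℂ] N) ℝ ℝ).continuous.comp hL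
  obtain ⟨W, hW0, hW⟩ := exists_forall_hasDerivAt_linear hL' 0 W₀
  refine ⟨W, hW0, fun t => (hW t).congr_deriv ?_⟩
  simp only [ContinuousLinearMap.coe_restrictScalars', L, sum_apply, add_apply]
  rfl

theorem gronwallBound_zero_mul (K ε c x : ℝ) :
    gronwallBound 0 K (c * ε) x = c * gronwallBound 0 K ε x := by
  simp only [gronwallBound]
  split_ifs <;> ring

section SMulField

variable (X : Type*) [CStarAlgebra X]

/-- Pointwise multiplication of `X`-valued functions on the state space by scalar functions. -/
def smulField : C(StateSpace X, ℂ) →L[ℂ] C(StateSpace X, X) →L[ℂ] C(StateSpace X, X) :=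
  LinearMap.mkContinuous₂
    (LinearMap.mk₂ ℂ (fun (a : C(StateSpace X, ℂ)) (F : C(StateSpace X, X)) => a • F)
      (fun a b F => by ext ρ; exact add_smul (a ρ) (b ρ) (F ρ))
      (fun z a F => by ext ρ; exact smul_assoc z (a ρ) (F ρ))
      (fun a F G => by ext ρ; exact smul_add (a ρ) (F ρ) (G ρ))
      (fun z a F => by ext ρ; exact smul_comm (a ρ) z (F ρ))) 1 fun a F => by
    rw [one_mul]
    refine (ContinuousMap.norm_le _ (by positivity)).2 fun ρ => ?_
    change ‖a ρ • F ρ‖ ≤ _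
    rw [norm_smul]
    exact mul_le_mul (a.norm_coe_le_norm ρ) (F.norm_coe_le_norm ρ) (norm_nonneg _) (norm_nonneg _)

variable {X}

/-- Constant fields. -/
def constField (X : Type*) [CStarAlgebra X] : X →L[ℂ] C(StateSpace X, X) :=
  LinearMap.mkContinuous
    { toFun := fun A => ContinuousMap.const _ A
      map_add' := fun _ _ => rfl
      map_smul' := fun _ _ => rfl } 1 fun A => by
    rw [one_mul]
    exact (ContinuousMap.norm_le _ (norm_nonneg _)).2 fun ρ => le_rfl

end SMulField

namespace CylindricalData

variable {X : Type*} [CStarAlgebra X] (D : CylindricalData X)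

/-- A continuous function of the coordinates along the flow. -/
def alongFlow {f : (Fin D.n → ℝ) → ℝ} (hf : Continuous f) : C(ℝ, C(StateSpace X, ℂ)) :=
  ContinuousMap.curry ⟨fun p => (f (D.coord (D.flow p.1 p.2).toDual) : ℂ),
    Complex.continuous_ofReal.comp (hf.comp (D.continuous_coord_toDual.comp D.continuous_flow))⟩

/-- The coefficient `A ↦ ∂ₖ∂ⱼg Φₜ(i[Bⱼ, A])` of the linearized equation. -/
def linCoef (j k : Fin D.n) (t : ℝ) : X →L[ℂ] C(StateSpace X, ℂ) :=
  (ContinuousLinearMap.mul ℂ C(StateSpace X, ℂ) (D.alongFlow (D.continuous_cc j k) t)).comp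
    ((D.Phi t).comp (D.ad j))

theorem continuous_linCoef (j k : Fin D.n) : Continuous (D.linCoef j k) :=
  ((ContinuousLinearMap.mul ℂ C(StateSpace X, ℂ)).continuous.comp
    (D.alongFlow (D.continuous_cc j k)).continuous).clm_comp
      (D.continuous_Phi.clm_comp continuous_const)

/-- A gradient must be an element of `X` depending norm-continuously on `ρ`. Hence the variation in
direction `υ - ρ` is sought as the pairing of `υ - ρ` with `W t A ρ`, which turns the linearized
equation into one for `W`. -/
theorem exists_linearizedFlow : ∃ W : ℝ → (X →L[ℂ] C(StateSpace X, X)), W 0 = constField X ∧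
    ∀ t, HasDerivAt W (∑ j, ((smulField X (D.alongFlow (D.continuous_c j) t)).comp
      ((W t).comp (D.ad j)) + ∑ k, ((smulField X).flip (W t (D.B k))).comp (D.linCoef j k t))) t :=
  exists_linear_family (smulField X) D.ad D.B (a := fun j => D.alongFlow (D.continuous_c j))
    (fun j => (D.alongFlow (D.continuous_c j)).continuous) D.continuous_linCoef _

/-- The adjoint of the linearized flow, as a field of elements of `X`. -/
def linearizedFlow : ℝ → (X →L[ℂ] C(StateSpace X, X)) := D.exists_linearizedFlow.choose

/-- The variation of the flow at `ρ` in the direction of `υ`. -/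
def variation (ρ υ : StateSpace X) (t : ℝ) : X →L[ℂ] ℂ :=
  ((υ.toDual - ρ.toDual).comp (ContinuousMap.evalCLM ℂ ρ)).comp (D.linearizedFlow t)

theorem variation_apply (ρ υ : StateSpace X) (t : ℝ) (A : X) :
    D.variation ρ υ t A = υ.1 (D.linearizedFlow t A ρ) - ρ.1 (D.linearizedFlow t A ρ) := rfl

theorem variation_zero (ρ υ : StateSpace X) : D.variation ρ υ 0 = υ.toDual - ρ.toDual := by
  rw [variation, linearizedFlow, D.exists_linearizedFlow.choose_spec.1]
  rfl

theorem hasDerivAt_variation (ρ υ : StateSpace X) (t : ℝ) :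
    HasDerivAt (D.variation ρ υ) (D.linField (D.flow t ρ).toDual (D.variation ρ υ t)) t := by
  refine (hasDerivAt_comp_left ((υ.toDual - ρ.toDual).comp (ContinuousMap.evalCLM ℂ ρ))
    (D.exists_linearizedFlow.choose_spec.2 t)).congr_deriv ?_
  ext A
  have hℓ : ∀ (a : C(StateSpace X, ℂ)) (F : C(StateSpace X, X)),
      ((υ.toDual - ρ.toDual).comp (ContinuousMap.evalCLM ℂ ρ)) (smulField X a F) =
        a ρ * ((υ.toDual - ρ.toDual).comp (ContinuousMap.evalCLM ℂ ρ)) F := fun a F => by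
    change (υ.toDual - ρ.toDual) (a ρ • F ρ) = _
    rw [map_smul]; rfl
  simp only [ContinuousLinearMap.comp_apply (g := (υ.toDual - ρ.toDual).comp _), linField,
    sum_apply, add_apply, map_sum, map_add, smul_apply, smul_eq_mul]
  refine Finset.sum_congr rfl fun j _ => ?_
  congr 1
  · exact hℓ _ _
  · rw [Finset.sum_mul]
    refine Finset.sum_congr rfl fun k _ => ?_
    refine (hℓ _ _).trans ?_
    change (D.cc j k (D.coord (D.flow t ρ).toDual) : ℂ) * D.Phi t (D.ad j A) ρ *
      D.variation ρ υ t (D.B k) = _ * D.Phi t (D.ad j A) ρ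
    ring

/-- The remainder starts at zero and satisfies the linearized equation up to the quadratic error of
the field. That error is of order `l ^ 2` because the flow is Lipschitz in the initial state. -/
theorem exists_norm_flow_mix_sub_le (ρ υ : StateSpace X) (t : ℝ) :
    ∃ C, ∀ l : I, ‖(D.flow t (ρ.mix υ l)).toDual - (D.flow t ρ).toDual -
      (l : ℂ) • D.variation ρ υ t‖ ≤ (l : ℝ) ^ 2 * C := by
  -- `E` is the Lipschitz constant of the flow up to time `t`; the factor `2` below bounds the
  -- distance of two states.
  set E : ℝ := Real.exp (D.K * (D.β * 1 + 1) * |t|)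
  set C₀ : ℝ := D.K * (D.β ^ 2 + D.β) * (2 * E) ^ 2
  have hK := D.K_nonneg
  have hβ := D.β_nonneg
  refine ⟨gronwallBound 0 (D.K * (D.β + 1)) C₀ |t - 0|, fun l => ?_⟩
  have hl : (0 : ℝ) ≤ l := l.2.1
  have hmix : (ρ.mix υ l).toDual - ρ.toDual = (l : ℂ) • (υ.toDual - ρ.toDual) := by
    ext A
    simp only [sub_apply, smul_apply, StateSpace.toDual_apply, StateSpace.mix_apply, smul_eq_mul]
    ring
  have hdiff : ∀ s ∈ uIcc 0 t,
      ‖(D.flow s (ρ.mix υ l)).toDual - (D.flow s ρ).toDual‖ ≤ l * (2 * E) := fun s hs => by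
    have h1 := (D.isTrajectory_flow (ρ.mix υ l)).norm_sub_le (D.isTrajectory_flow ρ)
      (fun t => StateSpace.norm_toDual_le _) 0 s
    rw [flow_zero, flow_zero, hmix, norm_smul, Complex.norm_real, Real.norm_of_nonneg hl,
      sub_zero] at h1
    have h2 : ‖υ.toDual - ρ.toDual‖ ≤ 2 := (norm_sub_le _ _).trans
      (by linarith [υ.norm_toDual_le, ρ.norm_toDual_le])
    have h3 : |s| ≤ |t| := by
      simpa using abs_sub_left_of_mem_uIcc hs
    refine h1.trans ?_
    rw [mul_assoc]
    gcongr
    exact Real.exp_le_exp.2 (by gcongr)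
  rw [← gronwallBound_zero_mul]
  refine norm_le_gronwallBound_of_hasDerivAt (a := 0) (b := t)
    (u := fun s => (D.flow s (ρ.mix υ l)).toDual - (D.flow s ρ).toDual -
      (l : ℂ) • D.variation ρ υ s)
    (fun s _ => ((D.isTrajectory_flow (ρ.mix υ l) s).sub (D.isTrajectory_flow ρ s)).sub
      ((D.hasDerivAt_variation ρ υ s).const_smul (l : ℂ))) ?_ fun s hs => ?_
  · rw [flow_zero, flow_zero, hmix, variation_zero, sub_self, norm_zero]
  · set ψ := (D.flow s (ρ.mix υ l)).toDual with hψ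
    set φ := (D.flow s ρ).toDual with hφ
    have h1 : D.field ψ - D.field φ - (l : ℂ) • D.linField φ (D.variation ρ υ s) =
        D.linField φ (ψ - φ - (l : ℂ) • D.variation ρ υ s) +
          (D.field ψ - D.field φ - D.linField φ (ψ - φ)) := by
      rw [D.linField_sub φ (ψ - φ), linField_smul]; abel
    rw [h1]
    refine (norm_add_le _ _).trans (add_le_add
      (D.norm_linField_le (StateSpace.norm_toDual_le _)) ?_)
    refine (D.norm_field_sub_linField_le (StateSpace.norm_toDual_le _) fun k => ?_).trans ?_
    · rw [sub_apply, Complex.sub_im, StateSpace.toDual_apply, StateSpace.toDual_apply,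
        StateSpace.apply_im_eq_zero _ (D.isSelfAdjoint k),
        StateSpace.apply_im_eq_zero _ (D.isSelfAdjoint k), sub_zero]
    · calc D.K * (D.β ^ 2 + D.β) * ‖ψ - φ‖ ^ 2
          ≤ D.K * (D.β ^ 2 + D.β) * (l * (2 * E)) ^ 2 := by
            gcongr
            exact hdiff s hs
        _ = (l : ℝ) ^ 2 * C₀ := by simp only [C₀]; ring

/-- The gradient of `ρ ↦ Φₜ(A)(ρ)`. -/
def flowGradient (t : ℝ) (A : X) : C(StateSpace X, X) where
  toFun ρ := D.linearizedFlow t A ρ - ρ.1 (D.linearizedFlow t A ρ) • (1 : X)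
  continuous_toFun := by
    have h : Continuous fun ρ : StateSpace X => gelfandHatCLM X (D.linearizedFlow t A ρ) ρ :=
      continuous_eval.comp (((gelfandHatCLM X).continuous.comp
        (D.linearizedFlow t A).continuous).prodMk continuous_id)
    exact (D.linearizedFlow t A).continuous.sub (Continuous.smul h continuous_const)

theorem hasStateGradient_Phi (t : ℝ) (A : X) :
    HasStateGradient (D.Phi t A) (D.flowGradient t A) := by
  intro ρ υ
  obtain ⟨C, hC⟩ := D.exists_norm_flow_mix_sub_le ρ υ t
  have hval : υ.1 (D.flowGradient t A ρ) = D.variation ρ υ t A := by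
    change υ.1 (D.linearizedFlow t A ρ - ρ.1 (D.linearizedFlow t A ρ) • (1 : X)) = _
    rw [map_sub, map_smul, υ.apply_one, smul_eq_mul, mul_one, variation_apply]
  rw [hval, tendsto_iff_norm_sub_tendsto_zero]
  have hlim : Tendsto (fun l : I => (l : ℝ) * (C * ‖A‖)) (𝓝[>] 0) (𝓝 0) := by
    have : Continuous fun l : I => (l : ℝ) * (C * ‖A‖) := by fun_prop
    simpa using (this.tendsto 0).mono_left (nhdsWithin_le_nhds (s := Ioi (0 : I)))
  refine squeeze_zero' (Eventually.of_forall fun _ => norm_nonneg _) ?_ hlim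
  filter_upwards [self_mem_nhdsWithin] with l hl
  have hl : (0 : ℝ) < l := hl
  have hlC : (l : ℂ) ≠ 0 := by exact_mod_cast hl.ne'
  have h1 : (l : ℂ)⁻¹ * (D.Phi t A (ρ.mix υ l) - D.Phi t A ρ) - D.variation ρ υ t A =
      (l : ℂ)⁻¹ * (((D.flow t (ρ.mix υ l)).toDual - (D.flow t ρ).toDual -
        (l : ℂ) • D.variation ρ υ t) A) := by
    simp only [sub_apply, smul_apply, StateSpace.toDual_apply, flow_apply, smul_eq_mul]
    field_simp
  rw [h1, norm_mul, norm_inv, Complex.norm_real, Real.norm_of_nonneg hl.le]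
  refine (mul_le_mul_of_nonneg_left (ContinuousLinearMap.le_of_opNorm_le _ (hC l) A)
    (inv_nonneg.2 hl.le)).trans_eq ?_
  field_simp

end CylindricalData

/-! ### The chain rule along the flow -/

section ChainRule

variable {X : Type*} [CStarAlgebra X] {f : C(StateSpace X, ℂ)} {F : C(StateSpace X, X)}

theorem StateSpace.mix_mix (ρ υ : StateSpace X) (s l : I) (r : I)
    (hr : (r : ℝ) = s + l * (1 - s)) : (ρ.mix υ s).mix υ l = ρ.mix υ r := by
  refine StateSpace.toDual_injective ?_
  ext A
  have : (r : ℂ) = s + l * (1 - s) := by exact_mod_cast congrArg ((↑) : ℝ → ℂ) hr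
  simp only [StateSpace.toDual_apply, StateSpace.mix_apply, this]
  ring

/-- The gradient at the mixture is annihilated by the mixture itself, and `υ` differs from it by `(1
- s) (υ - ρ)`. -/
theorem HasStateGradient.apply_mix (h : HasStateGradient f F) (ρ υ : StateSpace X) (s : I) :
    υ.1 (F (ρ.mix υ s)) = (1 - (s : ℂ)) * (υ.toDual - ρ.toDual) (F (ρ.mix υ s)) := by
  have h1 := h.apply_self (ρ.mix υ s)
  rw [StateSpace.mix_apply] at h1
  simp only [sub_apply, StateSpace.toDual_apply]
  linear_combination h1

/-- Moving from `s` to `r` on the segment is mixing with `υ` with weight `(r - s) / (1 - s)`; the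
factor `1 - s` cancels against `apply_mix`. The convex derivative only gives a right derivative. -/
theorem HasStateGradient.hasDerivWithinAt_mix (h : HasStateGradient f F) (ρ υ : StateSpace X)
    {s : ℝ} (hs : s ∈ Ico (0 : ℝ) 1) :
    HasDerivWithinAt (fun r => f (ρ.mix υ (projIcc 0 1 zero_le_one r)))
      ((υ.toDual - ρ.toDual) (F (ρ.mix υ (projIcc 0 1 zero_le_one s)))) (Ici s) s := by
  set s' : I := projIcc 0 1 zero_le_one s with hs'
  have hss : (s' : ℝ) = s := by rw [hs', projIcc_of_mem _ (Ico_subset_Icc_self hs)]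
  have h1s : 0 < 1 - s := sub_pos.2 hs.2
  rw [← hasDerivWithinAt_Ioi_iff_Ici, hasDerivWithinAt_iff_tendsto_slope' self_notMem_Ioi]
  have hproj : ∀ r ∈ Ioo s 1, ((projIcc 0 1 zero_le_one ((r - s) / (1 - s)) : I) : ℝ) =
      (r - s) / (1 - s) := fun r hr => by
    rw [projIcc_of_mem _ ⟨div_nonneg (by linarith [hr.1]) h1s.le,
      (div_le_one h1s).2 (by linarith [hr.2])⟩]
  have hmem : Ioo s 1 ∈ 𝓝[>] s := Ioo_mem_nhdsGT hs.2
  have hlim : Tendsto (fun r => (projIcc 0 1 zero_le_one ((r - s) / (1 - s)) : I)) (𝓝[>] s)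
      (𝓝[>] 0) := by
    refine tendsto_nhdsWithin_iff.2 ⟨?_, ?_⟩
    · have hc : Continuous fun r => (projIcc 0 1 zero_le_one ((r - s) / (1 - s)) : I) :=
        continuous_projIcc.comp ((continuous_id.sub continuous_const).div_const _)
      have := (hc.tendsto s).mono_left (nhdsWithin_le_nhds (s := Ioi s))
      rwa [sub_self, zero_div, projIcc_left] at this
    · filter_upwards [hmem] with r hr
      change (0 : ℝ) < (projIcc 0 1 zero_le_one ((r - s) / (1 - s)) : I)
      rw [hproj r hr]
      exact div_pos (by linarith [hr.1]) h1s
  have key := ((h (ρ.mix υ s') υ).comp hlim).const_mul ((1 - (s : ℂ))⁻¹)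
  have hne : (1 - (s : ℂ)) ≠ 0 := by exact_mod_cast h1s.ne'
  rw [h.apply_mix ρ υ s', hss, inv_mul_cancel_left₀ hne] at key
  refine key.congr' ?_
  filter_upwards [hmem] with r hr
  have hr' : r ∈ Icc (0 : ℝ) 1 := ⟨hs.1.trans hr.1.le, hr.2.le⟩
  have hm : (ρ.mix υ s').mix υ (projIcc 0 1 zero_le_one ((r - s) / (1 - s))) =
      ρ.mix υ (projIcc 0 1 zero_le_one r) := by
    refine StateSpace.mix_mix _ _ _ _ _ ?_
    rw [hproj r hr, hss, projIcc_of_mem _ hr']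
    simp only
    field_simp
    ring
  have hrs : (r : ℂ) - s ≠ 0 := by exact_mod_cast (sub_pos.2 hr.1).ne'
  rw [Function.comp, hm, hproj r hr, slope_def_module, Complex.real_smul, ← mul_assoc]
  congr 1
  push_cast
  field_simp

/-- Mean value inequality on the segment after subtracting the linear part; right derivatives
suffice for it. -/
theorem HasStateGradient.norm_sub_le (h : HasStateGradient f F) (ρ υ : StateSpace X) {ε : ℝ}
    (hε : ∀ l : I, ‖F (ρ.mix υ l) - F ρ‖ ≤ ε) :
    ‖f υ - f ρ - (υ.toDual - ρ.toDual) (F ρ)‖ ≤ ‖υ.toDual - ρ.toDual‖ * ε := by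
  set z : ℂ := (υ.toDual - ρ.toDual) (F ρ) with hz
  have hc : Continuous fun r : ℝ => f (ρ.mix υ (projIcc 0 1 zero_le_one r)) - (r : ℂ) * z := by
    refine Continuous.sub ?_ (Complex.continuous_ofReal.mul continuous_const)
    exact f.continuous.comp ((StateSpace.continuous_mix ρ υ).comp continuous_projIcc)
  have := norm_image_sub_le_of_norm_deriv_right_le_segment (a := 0) (b := 1)
    (f := fun r : ℝ => f (ρ.mix υ (projIcc 0 1 zero_le_one r)) - (r : ℂ) * z)
    (f' := fun r => (υ.toDual - ρ.toDual) (F (ρ.mix υ (projIcc 0 1 zero_le_one r))) - z)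
    (C := ‖υ.toDual - ρ.toDual‖ * ε) hc.continuousOn (fun s hs => ?_) (fun s hs => ?_) 1
    (right_mem_Icc.2 zero_le_one)
  · rw [projIcc_left, projIcc_right] at this
    change ‖f (ρ.mix υ 1) - _ - (f (ρ.mix υ 0) - _)‖ ≤ _ at this
    rw [StateSpace.mix_one, StateSpace.mix_zero] at this
    convert this using 1
    · congr 1; push_cast; ring
    · ring
  · refine (h.hasDerivWithinAt_mix ρ υ hs).sub ?_
    have h1 : HasDerivAt (fun r : ℝ => (r : ℂ) * z) (1 * z) s :=
      (Complex.ofRealCLM.hasDerivAt (x := s)).mul_const z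
    rw [one_mul] at h1
    exact h1.hasDerivWithinAt
  · rw [hz, ← map_sub]
    exact ((υ.toDual - ρ.toDual).le_opNorm _).trans
      (mul_le_mul_of_nonneg_left (hε _) (norm_nonneg _))

end ChainRule

namespace CylindricalData

variable {X : Type*} [CStarAlgebra X] (D : CylindricalData X) {f : C(StateSpace X, ℂ)}
  {F : C(StateSpace X, X)}

theorem field_apply_gradient (ρ : StateSpace X) (A : X) :
    D.field ρ.toDual A = ρ.1 (Complex.I • (D.gradient ρ * A - A * D.gradient ρ)) := by
  rw [← comp_quantumGenerator, ← D.hasStateGradient_hamiltonian.stateGradient_eq]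
  rfl

theorem poissonBracket_hamiltonian (hF : HasStateGradient f F) (ρ : StateSpace X) :
    poissonBracket D.hamiltonian f ρ = D.field ρ.toDual (F ρ) := by
  rw [poissonBracket, D.hasStateGradient_hamiltonian.stateGradient_eq, hF.stateGradient_eq,
    field_apply_gradient]

/-- Replacing `f` by its linear part at `ρ` costs `O(t)` times the oscillation of `F` on the segment
from `ρ` to its image under the flow. This oscillation tends to zero, so the error is `o(t)`. -/
theorem hasDerivAt_apply_flow (hF : HasStateGradient f F) (ρ : StateSpace X) :
    HasDerivAt (fun t => f (D.flow t ρ)) (poissonBracket D.hamiltonian f ρ) 0 := by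
  rw [D.poissonBracket_hamiltonian hF]
  have hφ : HasDerivAt (fun t => (D.flow t ρ).toDual) (D.field ρ.toDual) 0 := by
    simpa only [flow_zero] using D.isTrajectory_flow ρ 0
  have hφF : HasDerivAt (fun t => (D.flow t ρ).toDual (F ρ)) (D.field ρ.toDual (F ρ)) 0 :=
    ((ContinuousLinearMap.apply ℂ ℂ (F ρ)).restrictScalars ℝ).hasFDerivAt.comp_hasDerivAt 0 hφ
  have hmix : Continuous fun p : ℝ × I => ρ.mix (D.flow p.1 ρ) p.2 := by
    rw [StateSpace.continuous_iff_apply]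
    intro A
    simp only [StateSpace.mix_apply]
    have h1 : Continuous fun p : ℝ × I => (D.flow p.1 ρ).1 A :=
      StateSpace.continuous_iff_apply.1 (D.continuous_flow.comp
        (by fun_prop : Continuous fun p : ℝ × I => (p.1, ρ))) A
    fun_prop
  -- Currying makes the convergence of `F` along the segments uniform in the mixing parameter.
  let G : C(ℝ, C(I, X)) := ContinuousMap.curry ⟨fun p => F (ρ.mix (D.flow p.1 ρ) p.2),
    F.continuous.comp hmix⟩
  have hG : Tendsto (fun t => ‖G t - G 0‖) (𝓝 0) (𝓝 0) := by
    have : Continuous fun t => ‖G t - G 0‖ := (G.continuous.sub continuous_const).norm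
    simpa using this.tendsto 0
  have hG0 : ∀ l, G 0 l = F ρ := fun l => by
    change F (ρ.mix (D.flow 0 ρ) l) = F ρ
    congr 1
    rw [flow_zero]
    refine StateSpace.toDual_injective ?_
    ext A
    simp only [StateSpace.toDual_apply, StateSpace.mix_apply]
    ring
  have herr : HasDerivAt (fun t => f (D.flow t ρ) - (D.flow t ρ).toDual (F ρ)) 0 0 := by
    rw [hasDerivAt_iff_isLittleO]
    have hO := hφ.isBigO_sub.norm_left.mul_isLittleO
      ((Asymptotics.isLittleO_one_iff ℝ).2 hG)
    simp only [mul_one, flow_zero] at hO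
    refine (Asymptotics.IsBigO.of_bound 1 (Eventually.of_forall fun t => ?_)).trans_isLittleO hO
    have hb := hF.norm_sub_le ρ (D.flow t ρ) (ε := ‖G t - G 0‖) fun l => by
      rw [← hG0 l]
      exact (G t - G 0).norm_coe_le_norm l
    rw [one_mul, smul_zero, sub_zero, flow_zero, norm_mul, norm_norm, norm_norm]
    refine le_trans (le_of_eq ?_) hb
    congr 1
    rw [sub_apply]
    ring
  have hs := herr.add hφF
  rw [zero_add] at hs
  exact hs.congr_of_eventuallyEq (Eventually.of_forall fun t => (sub_add_cancel _ _).symm)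

/-! ### Polynomials along the flow -/

/-- Composition with the flow. -/
def pullback (t : ℝ) : C(StateSpace X, ℂ) →⋆ₐ[ℂ] C(StateSpace X, ℂ) :=
  classicalEvolution D.flowFamily t 0

theorem pullback_apply (t : ℝ) (f : C(StateSpace X, ℂ)) (ρ : StateSpace X) :
    D.pullback t f ρ = f (D.flow t ρ) := by
  change f (D.flow (t - 0) ρ) = _
  rw [sub_zero]

theorem pullback_gelfandHat (t : ℝ) (A : X) : D.pullback t (gelfandHat A) = D.Phi t A := by
  ext ρ; rw [pullback_apply]; rfl

theorem pullback_zero : D.pullback 0 = StarAlgHom.id ℂ C(StateSpace X, ℂ) := by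
  ext f ρ; rw [pullback_apply, flow_zero]; rfl

theorem pullback_add (s t : ℝ) : D.pullback (s + t) = (D.pullback s).comp (D.pullback t) := by
  ext f ρ
  rw [StarAlgHom.comp_apply, pullback_apply, pullback_apply, pullback_apply, flow_flow, add_comm]

theorem norm_pullback_le (t : ℝ) (f : C(StateSpace X, ℂ)) : ‖D.pullback t f‖ ≤ ‖f‖ :=
  (ContinuousMap.norm_le _ (norm_nonneg _)).2 fun ρ => by
    rw [pullback_apply]; exact f.norm_coe_le_norm _

theorem isC0Group_pullback : IsC0Group D.pullback := by
  refine ⟨fun t => ?_, D.pullback_zero, D.pullback_add, fun f => ?_⟩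
  · have h : ∀ s t : ℝ, s + t = 0 → ∀ f, D.pullback s (D.pullback t f) = f := fun s t hst f => by
      rw [← StarAlgHom.comp_apply, ← pullback_add, hst, pullback_zero]; rfl
    exact Function.bijective_iff_has_inverse.2
      ⟨D.pullback (-t), h _ _ (neg_add_cancel t), h _ _ (add_neg_cancel t)⟩
  · have : Continuous fun t : ℝ => D.flowFamily (0, t) := by fun_prop
    exact (ContinuousMap.continuous_postcomp f).comp this

theorem exists_hasStateGradient_pullback (hf : f ∈ polynomialsOnStates X) (t : ℝ) :
    ∃ F, HasStateGradient (D.pullback t f) F := by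
  induction hf using Algebra.adjoin_induction with
  | mem f hf =>
    obtain ⟨A, rfl⟩ := hf
    rw [pullback_gelfandHat]
    exact ⟨_, D.hasStateGradient_Phi t A⟩
  | algebraMap z =>
    rw [AlgHomClass.commutes]
    exact ⟨0, HasStateGradient.algebraMap z⟩
  | add f g _ _ hf hg =>
    obtain ⟨F, hF⟩ := hf
    obtain ⟨G, hG⟩ := hg
    rw [map_add]
    exact ⟨_, hF.add hG⟩
  | mul f g _ _ hf hg =>
    obtain ⟨F, hF⟩ := hf
    obtain ⟨G, hG⟩ := hg
    rw [map_mul]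
    exact ⟨_, hF.mul hG⟩

/-- On Gelfand transforms this is the ODE for `Phi` in norm; multiplicativity of the pullback and
the Leibniz rule do the rest. -/
theorem differentiableAt_pullback (hf : f ∈ polynomialsOnStates X) :
    DifferentiableAt ℝ (fun t => D.pullback t f) 0 := by
  induction hf using Algebra.adjoin_induction with
  | mem f hf =>
    obtain ⟨A, rfl⟩ := hf
    simp only [pullback_gelfandHat]
    exact (((ContinuousLinearMap.apply ℂ C(StateSpace X, ℂ) A).restrictScalars ℝ).hasFDerivAt
      |>.comp_hasDerivAt 0 (D.hasDerivAt_Phi 0)).differentiableAt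
  | algebraMap z =>
    simp only [AlgHomClass.commutes]
    exact differentiableAt_const _
  | add f g _ _ hf hg =>
    simp only [map_add]
    exact hf.add hg
  | mul f g _ _ hf hg =>
    simp only [map_mul]
    exact hf.mul hg

/-- The norm derivative at time zero is transported to `t` by the contraction `D.pullback t`, which
commutes with the group. As it exists in norm, its values may be found pointwise from the chain
rule, with no uniformity in `ρ` needed there. -/
theorem exists_hasDerivAt_pullback (hf : f ∈ polynomialsOnStates X) :
    ∃ k : C(StateSpace X, ℂ), ∀ t, HasDerivAt (fun τ => D.pullback τ f) (D.pullback t k) t ∧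
      HasDerivAt (fun τ => D.pullback τ (D.pullback t f)) (D.pullback t k) 0 ∧
      ∀ ρ, D.pullback t k ρ = poissonBracket D.hamiltonian (D.pullback t f) ρ := by
  refine ⟨deriv (fun t => D.pullback t f) 0, fun t => ?_⟩
  have h0 := (D.differentiableAt_pullback hf).hasDerivAt
  set k := deriv (fun t => D.pullback t f) 0
  let Vt : C(StateSpace X, ℂ) →L[ℂ] C(StateSpace X, ℂ) :=
    LinearMap.mkContinuous (D.pullback t : C(StateSpace X, ℂ) →ₗ[ℂ] C(StateSpace X, ℂ)) 1
      fun f => by rw [one_mul]; exact D.norm_pullback_le t f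
  have h1 : HasDerivAt (fun τ => D.pullback t (D.pullback τ f)) (D.pullback t k) 0 :=
    (Vt.restrictScalars ℝ).hasFDerivAt.comp_hasDerivAt 0 h0
  have h2 : HasDerivAt (fun τ => D.pullback τ (D.pullback t f)) (D.pullback t k) 0 := by
    refine h1.congr_of_eventuallyEq (Eventually.of_forall fun τ => ?_)
    dsimp only
    rw [← StarAlgHom.comp_apply, ← StarAlgHom.comp_apply, ← pullback_add, ← pullback_add, add_comm]
  refine ⟨?_, h2, fun ρ => ?_⟩
  · have h3 : HasDerivAt (fun τ => D.pullback (t + τ) f) (D.pullback t k) 0 := by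
      refine h1.congr_of_eventuallyEq (Eventually.of_forall fun τ => ?_)
      dsimp only
      rw [← StarAlgHom.comp_apply, ← pullback_add]
    rw [← sub_self t] at h3
    have h4 := h3.comp_sub_const t t
    simpa only [add_sub_cancel] using h4
  · obtain ⟨F, hF⟩ := D.exists_hasStateGradient_pullback hf t
    have h3 : HasDerivAt (fun τ => D.pullback τ (D.pullback t f) ρ) (D.pullback t k ρ) 0 :=
      let e : C(StateSpace X, ℂ) →L[ℝ] ℂ := (ContinuousMap.evalCLM ℂ ρ).restrictScalars ℝ
      e.hasFDerivAt.comp_hasDerivAt 0 h2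
    simp only [D.pullback_apply _ (D.pullback t f)] at h3
    exact h3.unique (D.hasDerivAt_apply_flow hF ρ)

end CylindricalData

/-! ### Generator of a one-parameter group -/

section Generator

variable {𝔄 : Type*} [CStarAlgebra 𝔄] {V : ℝ → (𝔄 →⋆ₐ[ℂ] 𝔄)} {f g : 𝔄}

theorem tendsto_of_hasDerivAt_group (hV : V 0 = StarAlgHom.id ℂ 𝔄)
    (h : HasDerivAt (fun t => V t f) g 0) :
    Tendsto (fun t : ℝ => t⁻¹ • (V t f - f)) (𝓝[≠] 0) (𝓝 g) := by
  refine h.tendsto_slope.congr fun t => ?_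
  rw [slope_def_module, sub_zero, hV]; rfl

theorem mem_groupGenerator_domain (hV : V 0 = StarAlgHom.id ℂ 𝔄)
    (h : HasDerivAt (fun t => V t f) g 0) : f ∈ (groupGenerator V).domain :=
  ⟨g, tendsto_of_hasDerivAt_group hV h⟩

theorem groupGenerator_apply (hV : V 0 = StarAlgHom.id ℂ 𝔄)
    (h : HasDerivAt (fun t => V t f) g 0) (hf : f ∈ (groupGenerator V).domain) :
    groupGenerator V ⟨f, hf⟩ = g :=
  tendsto_nhds_unique hf.choose_spec (tendsto_of_hasDerivAt_group hV h)

end Generator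

/-! ### Assembly of the main theorem -/

theorem exists_cylindricalData {X : Type*} [CStarAlgebra X] {h : C(StateSpace X, ℂ)}
    (hh : (fun _ : ℝ => h) ∈ cylindricalHamiltonians X) :
    ∃ D : CylindricalData X, D.hamiltonian = h := by
  obtain ⟨n, B, g, hB, hg, ⟨M, hM⟩, -, hgh⟩ := hh
  -- The representing `g` may depend on time even though `h` does not; any time slice will do.
  refine ⟨⟨n, B, g 0, M, hB, hg 0, fun m hm x => hM 0 x m hm⟩, ?_⟩
  ext ρ
  exact (hgh 0 ρ).symm

end

theorem mainTheorem6 {X : Type*} [CStarAlgebra X] (h : C(StateSpace X, ℂ))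
    (hh : (fun _ : ℝ => h) ∈ cylindricalHamiltonians X) :
    (∀ ξ : C(ℝ, StateSpace X), ∃! T, IsQuantumEvolution (fun _ => h) ξ T) ∧
    (∃! ϖ : C(ℝ × ℝ, C(StateSpace X, StateSpace X)), IsSelfConsistentFlow (fun _ => h) ϖ) ∧
    ∀ ϖ : C(ℝ × ℝ, C(StateSpace X, StateSpace X)), IsSelfConsistentFlow (fun _ => h) ϖ →
      ∀ V : ℝ → (C(StateSpace X, ℂ) →⋆ₐ[ℂ] C(StateSpace X, ℂ)),
        V = (fun t => classicalEvolution ϖ t 0) →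
        IsC0Group V ∧ IsContDiffOnStates h ∧
        ∀ (t : ℝ) (f : C(StateSpace X, ℂ)), f ∈ polynomialsOnStates X →
          IsContDiffOnStates f ∧ IsContDiffOnStates (V t f) ∧
          ∃ (hf : f ∈ (groupGenerator V).domain) (hVf : V t f ∈ (groupGenerator V).domain)
            (k : C(StateSpace X, ℂ)),
            (∀ ρ, k ρ = poissonBracket h f ρ) ∧
            HasDerivAt (fun τ => V τ f) (V t (groupGenerator V ⟨f, hf⟩)) t ∧
            V t (groupGenerator V ⟨f, hf⟩) = V t k ∧
            (∀ ρ, V t k ρ = poissonBracket h (V t f) ρ) ∧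
            V t k = groupGenerator V ⟨V t f, hVf⟩ := by
  obtain ⟨D, rfl⟩ := exists_cylindricalData hh
  refine ⟨D.existsUnique_isQuantumEvolution,
    ⟨D.flowFamily, D.isSelfConsistentFlow_flowFamily, fun ϖ hϖ => D.eq_flowFamily hϖ⟩, ?_⟩
  rintro ϖ hϖ V rfl
  obtain rfl := D.eq_flowFamily hϖ
  change IsC0Group D.pullback ∧ _
  refine ⟨D.isC0Group_pullback, D.hasStateGradient_hamiltonian.isContDiffOnStates,
    fun t f hf => ?_⟩
  change _ ∧ IsContDiffOnStates (D.pullback t f) ∧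
    ∃ (hf : f ∈ (groupGenerator D.pullback).domain)
      (hVf : D.pullback t f ∈ (groupGenerator D.pullback).domain) (k : C(StateSpace X, ℂ)),
      (∀ ρ, k ρ = poissonBracket D.hamiltonian f ρ) ∧
      HasDerivAt (fun τ => D.pullback τ f)
        (D.pullback t (groupGenerator D.pullback ⟨f, hf⟩)) t ∧
      D.pullback t (groupGenerator D.pullback ⟨f, hf⟩) = D.pullback t k ∧
      (∀ ρ, D.pullback t k ρ = poissonBracket D.hamiltonian (D.pullback t f) ρ) ∧
      D.pullback t k = groupGenerator D.pullback ⟨D.pullback t f, hVf⟩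
  obtain ⟨k, hk⟩ := D.exists_hasDerivAt_pullback hf
  obtain ⟨F, hF⟩ := D.exists_hasStateGradient_pullback hf 0
  obtain ⟨G, hG⟩ := D.exists_hasStateGradient_pullback hf t
  have hid : ∀ f, D.pullback 0 f = f := fun f => by rw [D.pullback_zero]; rfl
  -- Time zero identifies `k` with the generator on `f` and with the bracket of `h` and `f`; time
  -- `t` does the same for the evolved function.
  obtain ⟨h0, -, hb0⟩ := hk 0
  obtain ⟨ht, ht0, hbt⟩ := hk t
  rw [hid] at hF h0
  have hgf := mem_groupGenerator_domain D.pullback_zero h0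
  have hgV := mem_groupGenerator_domain D.pullback_zero ht0
  have hval := groupGenerator_apply D.pullback_zero h0 hgf
  refine ⟨hF.isContDiffOnStates, hG.isContDiffOnStates, hgf, hgV, k, fun ρ => ?_, ?_, ?_, hbt,
    (groupGenerator_apply D.pullback_zero ht0 hgV).symm⟩
  · simpa only [hid] using hb0 ρ
  · rw [hval]; exact ht
  · rw [hval]
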